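/- **Setting.** Let $\mathcal A$ be a finite set of arms with vectors $x_a\in\mathbb R^d$, $\|x_a\|_2=1$, and let $\theta^*\in\mathbb R^d$ be unknown with $\|\theta^*\|_2\le 1$. Let $\mathcal K$ be a finite set of key-terms, with weights $w_{a,k}\ge 0$ such that $\sum_a w_{a,k}>0$ for every $k$ and $\sum_k w_{a,k}=1$ for every $a$. The key-term vectors $\tilde x_k=\sum_a \frac{w_{a,k}}{\sum_{a'}w_{a',k}}x_a$ are assumed to span $\mathbb R^d$. Let $\mathcal B\subseteq\mathcal K$, $|\mathcal B|=d$, be a barycentric spanner of $\mathcal K$: every $\tilde x_k$ ($k\in\mathcal K$) is a linear combination of $\{\tilde x_j\}_{j\in\mathcal B}$ with coefficients in $[-1,1]$. Let $\lambda_{\mathcal B}$ be the smallest eigenvalue of $\frac1d\sum_{k\in\mathcal B}\tilde x_k\tilde x_k^\top$. Let $b\in(0,1)$, $\beta>0$, $\delta\in(0,\frac14]$. **Algorithm (ConLinUCB-BS).** In each round $t=1,\dots,T$: 1. The agent asks $q(t)=\lfloor bt\rfloor-\lfloor b(t-1)\rfloor$ key-terms (so $\lfloor bt\rfloor$ in total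 up to round $t$), each drawn uniformly from $\mathcal B$ independently of the past. For each it receives the feedback $\tilde x_k^\top\theta^*+\tilde\epsilon$. 2. It computes $\theta_t=M_t^{-1}b_t$, where $M_t$ is $\beta I$ plus the sum of $vv^\top$ over the vectors $v$ of all arms played before round $t$ and of all key-terms asked up to round $t$, and $b_t$ is the sum of these $v$ multiplied by the observed rewards and feedbacks. 3. From the (possibly random, history-dependent) available set $\mathcal A_t\subseteq\mathcal A$ it plays an arm $a_t$ that maximizes $x_a^\top\theta_t+\alpha_t\sqrt{x_a^\top M_t^{-1}x_a}$ over $a\in\mathcal A_t$, where $$\alpha_t=\sqrt{2\log\tfrac{2}{\delta}+d\log\Big(1+\tfrac{t+bt}{\beta d}\Big)}+\sqrt\beta ,$$ and receives the reward $r_t=x_{a_t}^\top\theta^*+\epsilon_t\in[0,1]$. Each noise variable is $1$-sub-Gaussian with mean zero, conditionally on the past observations and on the key-term asked, respectively the arm played. The regret is $R(T)=\sum_{t=1}^T\big(\max_{a\in\mathcal A_t}x_a^\top\theta^*-x_{a_t}^\top\theta^*\big)$. **Theorem.** One has $0<\lambda_{\mathcal B}\le 1/d$, and with probability at least $1-\delta$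 $$R(T)\le 4\sqrt{\frac{2}{b\lambda_{\mathcal B}}}\,\sqrt T\left(\sqrt{2\log\frac2\delta+d\log\Big(1+\frac{(1+b)T}{\beta d}\Big)}+\sqrt\beta\right)+\frac{256}{b\lambda_{\mathcal B}^2}\log\frac{256d}{\lambda_{\mathcal B}^2\delta}+1 .$$ Moreover, for every $c>0$ there is a constant $C>0$ depending only on $b,\beta,\delta,c$ such that, whenever $\lambda_{\mathcal B}\ge c/d$ and $T\ge 2$, with probability at least $1-\delta$ one has $R(T)\le C\,d\sqrt{T\log T}$. -/

import Mathlib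

open MeasureTheory ProbabilityTheory Matrix

noncomputable section

namespace ConvBandit

/-- Feature vector of the key-term `k`: the average of the arm vectors `x a`, weighted by the
normalised weights of the arms related to `k`. -/
def keyTermVec {d : ℕ} {A K : Type*} [Fintype A] (x : A → Fin d → ℝ) (w : A → K → ℝ) (k : K) :
    Fin d → ℝ :=
  ∑ a, (w a k / ∑ a', w a' k) • x a

/-- A conversational linear bandit problem: finitely many arms with unit feature vectors, finitely
many key-terms, a weighted bipartite graph between them, and the unknown preference vector `θ`.
The key-term feature vectors span `ℝ^d`. -/
structure Problem (d : ℕ) (A K : Type*) [Fintype A] [Fintype K] where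
  x : A → Fin d → ℝ
  w : A → K → ℝ
  θ : Fin d → ℝ
  norm_x : ∀ a, ‖WithLp.toLp 2 (x a)‖ = 1
  norm_θ : ‖WithLp.toLp 2 θ‖ ≤ 1
  w_nonneg : ∀ a k, 0 ≤ w a k
  sum_w_pos : ∀ k, 0 < ∑ a, w a k
  sum_w_eq_one : ∀ a, ∑ k, w a k = 1
  span_key : Submodule.span ℝ (Set.range (keyTermVec x w)) = ⊤

namespace Problem

variable {d : ℕ} {A K : Type*} [Fintype A] [Fintype K]

/-- Feature vector of a key-term of the problem. -/
def xt (P : Problem d A K) (k : K) : Fin d → ℝ := keyTermVec P.x P.w k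

/-- `B` is a set of `d` key-terms such that every key-term vector is a linear combination of the
vectors of `B` with coefficients in `[-1, 1]`. -/
def IsBarycentricSpanner (P : Problem d A K) (B : Finset K) : Prop :=
  B.card = d ∧
    ∀ k : K, ∃ c : K → ℝ, (∀ j ∈ B, c j ∈ Set.Icc (-1 : ℝ) 1) ∧ P.xt k = ∑ j ∈ B, c j • P.xt j

end Problem

/-- Smallest eigenvalue of a (symmetric) real matrix. -/
def lambdaMin {d : ℕ} (M : Matrix (Fin d) (Fin d) ℝ) : ℝ := sInf (spectrum ℝ M)

/-- `λ_B`: the smallest eigenvalue of `E[x̃_k x̃_kᵀ]`, with `k` uniform on `B`. -/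
def Problem.lambdaB {d : ℕ} {A K : Type*} [Fintype A] [Fintype K] (P : Problem d A K)
    (B : Finset K) : ℝ :=
  lambdaMin ((B.card : ℝ)⁻¹ • ∑ k ∈ B, vecMulVec (P.xt k) (P.xt k))

/-- Number of key-terms asked in round `t ≥ 1` when the budget is `b(t) = b t`. In total,
`⌊b t⌋` key-terms have been asked after the conversations of round `t`. -/
def queries (b : ℝ) (t : ℕ) : ℕ := ⌊b * (t : ℝ)⌋₊ - ⌊b * ((t : ℝ) - 1)⌋₊

/-- The random quantities of an interaction. Rounds are numbered from `1`; the key-terms asked in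
round `t` are `key t i` with `i < queries b t`, asked in this order, and then `arm t` is played. -/
structure Interaction (Ω A K : Type*) where
  avail : ℕ → Ω → Finset A
  key : ℕ → ℕ → Ω → K
  keyNoise : ℕ → ℕ → Ω → ℝ
  arm : ℕ → Ω → A
  noise : ℕ → Ω → ℝ

namespace Interaction

variable {d : ℕ} {Ω A K : Type*} [Fintype A] [Fintype K]

/-- Reward of the arm played in round `t`. -/
def reward (I : Interaction Ω A K) (P : Problem d A K) (t : ℕ) (ω : Ω) : ℝ :=
  P.x (I.arm t ω) ⬝ᵥ P.θ + I.noise t ω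

/-- Feedback on the `i`-th key-term asked in round `t`. -/
def feedback (I : Interaction Ω A K) (P : Problem d A K) (t i : ℕ) (ω : Ω) : ℝ :=
  P.xt (I.key t i ω) ⬝ᵥ P.θ + I.keyNoise t i ω

/-- The matrix `M_t` used to select the arm of round `t`: arms of the rounds before `t`, key-terms
of the rounds up to `t`, and the regulariser. -/
def gram (I : Interaction Ω A K) (P : Problem d A K) (b β : ℝ) (t : ℕ) (ω : Ω) :
    Matrix (Fin d) (Fin d) ℝ :=
  (∑ τ ∈ Finset.Ico 1 t, vecMulVec (P.x (I.arm τ ω)) (P.x (I.arm τ ω))) +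
    (∑ τ ∈ Finset.Icc 1 t, ∑ i ∈ Finset.range (queries b τ),
      vecMulVec (P.xt (I.key τ i ω)) (P.xt (I.key τ i ω))) +
    β • (1 : Matrix (Fin d) (Fin d) ℝ)

/-- The vector `b_t` of the regularised least-squares problem of round `t`. -/
def target (I : Interaction Ω A K) (P : Problem d A K) (b : ℝ) (t : ℕ) (ω : Ω) : Fin d → ℝ :=
  (∑ τ ∈ Finset.Ico 1 t, I.reward P τ ω • P.x (I.arm τ ω)) +
    ∑ τ ∈ Finset.Icc 1 t, ∑ i ∈ Finset.range (queries b τ),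
      I.feedback P τ i ω • P.xt (I.key τ i ω)

/-- The estimate `θ_t = M_t⁻¹ b_t`. -/
def estimate (I : Interaction Ω A K) (P : Problem d A K) (b β : ℝ) (t : ℕ) (ω : Ω) : Fin d → ℝ :=
  (I.gram P b β t ω)⁻¹ *ᵥ I.target P b t ω

end Interaction

/-- `‖v‖_M = √(vᵀ M v)`. -/
def matNorm {d : ℕ} (M : Matrix (Fin d) (Fin d) ℝ) (v : Fin d → ℝ) : ℝ := √(v ⬝ᵥ (M *ᵥ v))

/-- The confidence width `α_t` at confidence level `δ`. -/
def alpha (d : ℕ) (b β δ : ℝ) (t : ℕ) : ℝ :=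
  √(2 * Real.log (1 / δ) + d * Real.log (1 + (t + b * t) / (β * d))) + √β

namespace Interaction

variable {d : ℕ} {Ω A K : Type*} [Fintype A] [Fintype K]

/-- The upper confidence index of the arm `a` in round `t`. -/
def index (I : Interaction Ω A K) (P : Problem d A K) (b β δ : ℝ) (t : ℕ) (ω : Ω) (a : A) : ℝ :=
  P.x a ⬝ᵥ I.estimate P b β t ω + alpha d b β δ t * matNorm (I.gram P b β t ω)⁻¹ (P.x a)

/-- The cumulative regret `R(T)`. -/
def regret (I : Interaction Ω A K) (P : Problem d A K) (T : ℕ) (ω : Ω) : ℝ :=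
  ∑ t ∈ Finset.Icc 1 T,
    (sSup ((fun a => P.x a ⬝ᵥ P.θ) '' (I.avail t ω : Set A)) - P.x (I.arm t ω) ⬝ᵥ P.θ)

/-- The information available in round `t` just before the `i`-th key-term of that round is asked
(for `i = queries b t`: just before the arm of round `t` is chosen): all key-terms, feedback, arms
and rewards so far. -/
@[reducible]
def history [MeasurableSpace A] [MeasurableSpace K] (I : Interaction Ω A K) (P : Problem d A K)
    (b : ℝ) (t i : ℕ) : MeasurableSpace Ω :=
  (⨆ τ ∈ Finset.Ico 1 t,
    MeasurableSpace.comap (I.arm τ) inferInstance ⊔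
      MeasurableSpace.comap (I.reward P τ) inferInstance) ⊔
  (⨆ τ ∈ Finset.Ico 1 t, ⨆ j ∈ Finset.range (queries b τ),
    MeasurableSpace.comap (I.key τ j) inferInstance ⊔
      MeasurableSpace.comap (I.feedback P τ j) inferInstance) ⊔
  (⨆ j ∈ Finset.range i,
    MeasurableSpace.comap (I.key t j) inferInstance ⊔
      MeasurableSpace.comap (I.feedback P t j) inferInstance)

end Interaction

/-- `X` is `1`-sub-Gaussian (in particular of mean zero) conditionally on `m`. -/
def CondSubgaussianOne {Ω : Type*} (m : MeasurableSpace Ω) {mΩ : MeasurableSpace Ω} (X : Ω → ℝ)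
    (μ : Measure[mΩ] Ω) : Prop :=
  ∀ s : ℝ, Integrable (fun ω => Real.exp (s * X ω)) μ ∧
    μ[fun ω => Real.exp (s * X ω) | m] ≤ᵐ[μ] fun _ => Real.exp (s ^ 2 / 2)

/-- `I` is a run, over the rounds `1, …, T`, of ConLinUCB with key-terms drawn uniformly from `B`,
with conversation budget `b t`, regulariser `β` and confidence parameter `δ`, in the environment
`P`. Ties in the choice of the arm may be broken in any way, and the available sets may be random
and depend on the past. -/
structure IsConLinUCBBS {d : ℕ} {Ω A K : Type*} [Fintype A] [Fintype K]
    [MeasurableSpace A] [MeasurableSpace K] {mΩ : MeasurableSpace Ω} (μ : Measure Ω)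
    (P : Problem d A K) (B : Finset K) (b β δ : ℝ) (T : ℕ) (I : Interaction Ω A K) : Prop where
  measurableSet_avail : ∀ t a, MeasurableSet {ω | a ∈ I.avail t ω}
  measurable_key : ∀ t i, Measurable (I.key t i)
  measurable_keyNoise : ∀ t i, Measurable (I.keyNoise t i)
  measurable_arm : ∀ t, Measurable (I.arm t)
  measurable_noise : ∀ t, Measurable (I.noise t)
  /-- every key-term is uniform on `B` … -/
  key_law : ∀ t ∈ Finset.Icc 1 T, ∀ i < queries b t,
    HasLaw (I.key t i) (uniformOn (B : Set K)) μ
  /-- … and drawn independently of the past -/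
  key_indep : ∀ t ∈ Finset.Icc 1 T, ∀ i < queries b t,
    Indep (MeasurableSpace.comap (I.key t i) inferInstance) (I.history P b t i) μ
  /-- noise of the key-term feedback, given the past and the key-term asked -/
  keyNoise_subgaussian : ∀ t ∈ Finset.Icc 1 T, ∀ i < queries b t,
    CondSubgaussianOne (I.history P b t i ⊔ MeasurableSpace.comap (I.key t i) inferInstance)
      (I.keyNoise t i) μ
  /-- the arm played maximises the upper confidence index among the available arms -/
  arm_mem : ∀ t ∈ Finset.Icc 1 T, ∀ᵐ ω ∂μ, I.arm t ω ∈ I.avail t ω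
  arm_max : ∀ t ∈ Finset.Icc 1 T, ∀ᵐ ω ∂μ, ∀ a ∈ I.avail t ω,
    I.index P b β δ t ω a ≤ I.index P b β δ t ω (I.arm t ω)
  /-- noise of the reward, given the past and the arm played -/
  noise_subgaussian : ∀ t ∈ Finset.Icc 1 T,
    CondSubgaussianOne
      (I.history P b t (queries b t) ⊔ MeasurableSpace.comap (I.arm t) inferInstance)
      (I.noise t) μ
  reward_mem : ∀ t ∈ Finset.Icc 1 T, ∀ᵐ ω ∂μ, I.reward P t ω ∈ Set.Icc (0 : ℝ) 1

end ConvBandit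

end

/-! Two failure events of probability at most ε = δ/2 each are excluded; off them the regret bound
is deterministic.

Estimation: with Gram matrix M and noise sum S, the process det(M)^(-1/2) exp(Sᵀ M⁻¹ S / 2) is a
supermartingale. Adding a vector v with noise η multiplies it by a factor that depends only on η,
vᵀM⁻¹S and vᵀM⁻¹v. That factor is a one-dimensional Gaussian average of exp(λη - λ²/2), so
sub-Gaussianity applies (`mixture_rankOneUpdate`, `CondSubgaussianOne.lintegral_mul_mixture_le`).
Ville's inequality covers all rounds at once, and bounding the determinant by the trace yields the
width `alpha`.

Exploration: a second exponential supermartingale shows that each key-term of B is asked at least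
3⌊bt⌋/(4d) - 2 log(d/ε) times (`measure_exists_keyCount_le`). Once t ≥ 10 d log(d/ε)/b this is at
least bt/(2d), so M_t ≥ (b t λ_B / 2) I, and every arm has norm at most √(2/(b λ_B t)) in M_t⁻¹
(`matNorm_inv_gram_le`). The key-terms alone achieve this, whatever arms are played.

By optimism a round costs at most twice the width of the arm played. Summing 1/√t gives the main
term, and early rounds cost at most 2 each (`Interaction.regret_le`). Since λ_B ≤ 1/d, the early
cost fits the stated logarithmic term. For the rate d√(T log T), the trivial bound 2T suffices when
√T ≤ d; otherwise d ≤ T and the logarithms are absorbed into the constant. -/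

namespace ConvBandit

/-! ### Rank-one updates, quadratic forms and the smallest eigenvalue. -/

section LinearAlgebra

variable {d : ℕ}

theorem posSemidef_vecMulVec_self (v : Fin d → ℝ) : (vecMulVec v v).PosSemidef := by
  simpa using posSemidef_vecMulVec_self_star v

theorem dotProduct_mulVec_comm {M : Matrix (Fin d) (Fin d) ℝ} (hM : M.IsHermitian)
    (u v : Fin d → ℝ) : u ⬝ᵥ M *ᵥ v = v ⬝ᵥ M *ᵥ u := by
  have h : Mᵀ = M := by simpa [IsHermitian, conjTranspose_eq_transpose_of_trivial] using hM
  rw [dotProduct_mulVec, ← mulVec_transpose, h, dotProduct_comm]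

theorem dotProduct_vecMulVec_mulVec (u v : Fin d → ℝ) :
    u ⬝ᵥ vecMulVec v v *ᵥ u = (v ⬝ᵥ u) ^ 2 := by
  simp [vecMulVec_mulVec, dotProduct_comm u v, sq]

theorem det_add_vecMulVec {M : Matrix (Fin d) (Fin d) ℝ} (hM : M.PosDef) (v : Fin d → ℝ) :
    (M + vecMulVec v v).det = M.det * (1 + v ⬝ᵥ M⁻¹ *ᵥ v) := by
  have hu : IsUnit M.det := hM.det_pos.ne'.isUnit
  have h : M + vecMulVec v v
      = M * (1 + replicateCol Unit (M⁻¹ *ᵥ v) * replicateRow Unit v) := by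
    rw [Matrix.mul_add, mul_one, ← vecMulVec_eq, mul_vecMulVec, mulVec_mulVec,
      mul_nonsing_inv _ hu, one_mulVec]
  rw [h, det_mul, det_one_add_replicateCol_mul_replicateRow]

theorem inv_add_vecMulVec {M : Matrix (Fin d) (Fin d) ℝ} (hM : M.PosDef) (v : Fin d → ℝ) :
    (M + vecMulVec v v)⁻¹ =
      M⁻¹ - (1 + v ⬝ᵥ M⁻¹ *ᵥ v)⁻¹ • vecMulVec (M⁻¹ *ᵥ v) (M⁻¹ *ᵥ v) := by
  have hu : IsUnit M.det := hM.det_pos.ne'.isUnit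
  have hs : 0 ≤ v ⬝ᵥ M⁻¹ *ᵥ v := by
    simpa using hM.inv.posSemidef.dotProduct_mulVec_nonneg v
  have hs' : 1 + v ⬝ᵥ M⁻¹ *ᵥ v ≠ 0 := by positivity
  have ht : v ᵥ* M⁻¹ = M⁻¹ *ᵥ v := by
    have h : M⁻¹ᵀ = M⁻¹ := by
      simpa [IsHermitian, conjTranspose_eq_transpose_of_trivial] using hM.inv.isHermitian
    rw [← mulVec_transpose, h]
  apply inv_eq_right_inv
  rw [Matrix.mul_sub, Matrix.mul_smul, Matrix.add_mul, Matrix.add_mul, mul_nonsing_inv _ hu,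
    mul_vecMulVec, mulVec_mulVec, mul_nonsing_inv _ hu, one_mulVec, vecMulVec_mul, ht,
    vecMulVec_mul_vecMulVec]
  generalize v ⬝ᵥ M⁻¹ *ᵥ v = s at *
  ext i j
  simp [vecMulVec_apply]
  field_simp
  ring

/-- Sherman–Morrison leaves only the scalars vᵀM⁻¹S and vᵀM⁻¹v, which reduces a vector-valued update
to a scalar one. -/
theorem quadForm_rankOneUpdate {M : Matrix (Fin d) (Fin d) ℝ} (hM : M.PosDef)
    (S v : Fin d → ℝ) (η : ℝ) :
    (S + η • v) ⬝ᵥ (M + vecMulVec v v)⁻¹ *ᵥ (S + η • v) =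
      S ⬝ᵥ M⁻¹ *ᵥ S + (2 * η * (v ⬝ᵥ M⁻¹ *ᵥ S) + (v ⬝ᵥ M⁻¹ *ᵥ v) * η ^ 2 -
        (v ⬝ᵥ M⁻¹ *ᵥ S) ^ 2) / (1 + v ⬝ᵥ M⁻¹ *ᵥ v) := by
  have hs : 0 ≤ v ⬝ᵥ M⁻¹ *ᵥ v := by
    simpa using hM.inv.posSemidef.dotProduct_mulVec_nonneg v
  have hs' : 1 + v ⬝ᵥ M⁻¹ *ᵥ v ≠ 0 := by positivity
  have h1 := dotProduct_mulVec_comm hM.inv.isHermitian S v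
  have h2 : (M⁻¹ *ᵥ v) ⬝ᵥ S = v ⬝ᵥ M⁻¹ *ᵥ S := by rw [dotProduct_comm, h1]
  have h3 : (M⁻¹ *ᵥ v) ⬝ᵥ v = v ⬝ᵥ M⁻¹ *ᵥ v := dotProduct_comm _ _
  rw [inv_add_vecMulVec hM, sub_mulVec, dotProduct_sub, smul_mulVec, dotProduct_smul,
    dotProduct_vecMulVec_mulVec]
  simp only [dotProduct_add, add_dotProduct, mulVec_add, mulVec_smul, dotProduct_smul,
    smul_dotProduct, smul_eq_mul, h1, h2, h3]
  field_simp
  ring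

/-- AM–GM for the eigenvalues, through the tangent line of the logarithm at m. -/
theorem log_det_le {M : Matrix (Fin d) (Fin d) ℝ} (hM : M.PosDef) {m : ℝ} (hm : 0 < m)
    (h : M.trace ≤ d * m) : Real.log M.det ≤ d * Real.log m := by
  have ht := hM.isHermitian.trace_eq_sum_eigenvalues
  have hd := hM.isHermitian.det_eq_prod_eigenvalues
  simp only [RCLike.ofReal_real_eq_id, id] at ht hd
  rw [hd, Real.log_prod (fun i _ => (hM.eigenvalues_pos i).ne')]
  have key : ∀ i, Real.log (hM.isHermitian.eigenvalues i) ≤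
      Real.log m + (hM.isHermitian.eigenvalues i / m - 1) := fun i => by
    have := Real.log_le_sub_one_of_pos (div_pos (hM.eigenvalues_pos i) hm)
    rw [Real.log_div (hM.eigenvalues_pos i).ne' hm.ne'] at this
    linarith
  refine (Finset.sum_le_sum fun i _ => key i).trans ?_
  rw [Finset.sum_add_distrib, Finset.sum_sub_distrib, ← Finset.sum_div, ← ht]
  simp only [Finset.sum_const, Finset.card_univ, Fintype.card_fin, nsmul_eq_mul, mul_one]
  have : M.trace / m ≤ d := by rw [div_le_iff₀ hm]; exact h
  linarith

theorem dotProduct_mulVec_sq_le {M : Matrix (Fin d) (Fin d) ℝ} (hM : M.PosSemidef)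
    (u v : Fin d → ℝ) : (u ⬝ᵥ M *ᵥ v) ^ 2 ≤ (u ⬝ᵥ M *ᵥ u) * (v ⬝ᵥ M *ᵥ v) := by
  -- Cauchy–Schwarz: the form at u + r v is a nonnegative quadratic in r, so its discriminant is
  -- nonpositive.
  have key : ∀ r : ℝ, 0 ≤ (v ⬝ᵥ M *ᵥ v) * (r * r) + (2 * (u ⬝ᵥ M *ᵥ v)) * r + u ⬝ᵥ M *ᵥ u := by
    intro r
    have h := hM.dotProduct_mulVec_nonneg (u + r • v)
    simp only [star_trivial, dotProduct_add, add_dotProduct, mulVec_add, mulVec_smul,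
      dotProduct_smul, smul_dotProduct, smul_eq_mul,
      dotProduct_mulVec_comm hM.isHermitian v u] at h
    linarith
  have := discrim_le_zero key
  unfold discrim at this
  nlinarith

theorem abs_dotProduct_mulVec_le {M : Matrix (Fin d) (Fin d) ℝ} (hM : M.PosSemidef)
    (u v : Fin d → ℝ) : |u ⬝ᵥ M *ᵥ v| ≤ matNorm M u * matNorm M v := by
  unfold matNorm
  rw [← Real.sqrt_mul (by simpa using hM.dotProduct_mulVec_nonneg u)]
  exact Real.abs_le_sqrt (dotProduct_mulVec_sq_le hM u v)

theorem dotProduct_sq_le (u v : Fin d → ℝ) : (u ⬝ᵥ v) ^ 2 ≤ (u ⬝ᵥ u) * (v ⬝ᵥ v) := by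
  simpa using dotProduct_mulVec_sq_le PosSemidef.one u v

/-- With y = M⁻¹x and p = xᵀM⁻¹x, coercivity at y gives c|y|² ≤ p and Cauchy–Schwarz gives p² ≤
|y|², hence p ≤ 1/c. -/
theorem matNorm_inv_le {M : Matrix (Fin d) (Fin d) ℝ} (hM : M.PosDef) {c : ℝ} (hc : 0 < c)
    (h : ∀ v, c * (v ⬝ᵥ v) ≤ v ⬝ᵥ M *ᵥ v) {x : Fin d → ℝ} (hx : x ⬝ᵥ x ≤ 1) :
    matNorm M⁻¹ x ≤ √(1 / c) := by
  refine Real.sqrt_le_sqrt ?_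
  have hu : IsUnit M.det := hM.det_pos.ne'.isUnit
  have h1 := h (M⁻¹ *ᵥ x)
  rw [mulVec_mulVec, mul_nonsing_inv _ hu, one_mulVec, dotProduct_comm _ x] at h1
  have h2 := dotProduct_sq_le x (M⁻¹ *ᵥ x)
  have h3 : 0 ≤ (M⁻¹ *ᵥ x) ⬝ᵥ (M⁻¹ *ᵥ x) := by simpa using dotProduct_star_self_nonneg (M⁻¹ *ᵥ x)
  have h4 : 0 ≤ x ⬝ᵥ M⁻¹ *ᵥ x := by simpa using hM.inv.posSemidef.dotProduct_mulVec_nonneg x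
  generalize x ⬝ᵥ M⁻¹ *ᵥ x = p at *
  generalize (M⁻¹ *ᵥ x) ⬝ᵥ (M⁻¹ *ᵥ x) = q at *
  rw [le_div_iff₀ hc]
  by_contra! hlt
  have : p ^ 2 ≤ q := h2.trans (by nlinarith)
  have hp : 0 < p := by nlinarith
  nlinarith

theorem dotProduct_self_eq_norm_sq (v : Fin d → ℝ) : v ⬝ᵥ v = ‖WithLp.toLp 2 v‖ ^ 2 := by
  rw [EuclideanSpace.norm_sq_eq]
  simp [dotProduct, sq]

/-- In dimension zero the spectrum is empty and the infimum takes the default value 0, hence `NeZero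
d`. -/
theorem lambdaMin_mem_range {M : Matrix (Fin d) (Fin d) ℝ} [NeZero d] (hM : M.IsHermitian) :
    ∃ i, hM.eigenvalues i = lambdaMin M := by
  have h := hM.spectrum_real_eq_range_eigenvalues
  have : sInf (Set.range hM.eigenvalues) ∈ Set.range hM.eigenvalues :=
    (Set.range_nonempty _).csInf_mem (Set.finite_range _)
  rw [← h] at this
  simpa [lambdaMin, h] using this

theorem lambdaMin_mul_le {M : Matrix (Fin d) (Fin d) ℝ} (hM : M.IsHermitian)
    (v : Fin d → ℝ) : lambdaMin M * (v ⬝ᵥ v) ≤ v ⬝ᵥ M *ᵥ v := by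
  have h : (M - lambdaMin M • 1).PosSemidef := by
    rw [posSemidef_iff_isHermitian_and_spectrum_nonneg]
    refine ⟨hM.sub (by simp [IsHermitian]), fun a ha => ?_⟩
    have ha' : a + lambdaMin M ∈ spectrum ℝ M := by
      rwa [← Algebra.algebraMap_eq_smul_one, sub_eq_neg_add, ← spectrum.add_mem_iff] at ha
    have : lambdaMin M ≤ a + lambdaMin M := by
      refine csInf_le ?_ ha'
      rw [hM.spectrum_real_eq_range_eigenvalues]
      exact (Set.finite_range _).bddBelow
    simpa using this
  have := h.dotProduct_mulVec_nonneg v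
  simp only [star_trivial, sub_mulVec, smul_mulVec, one_mulVec, dotProduct_sub, dotProduct_smul,
    smul_eq_mul] at this
  linarith

end LinearAlgebra

/-! ### Norm bounds on the features and the range of λ_B. -/

namespace Problem

variable {d : ℕ} {A K : Type*} [Fintype A] [Fintype K] (P : Problem d A K)

theorem dotProduct_x_self (a : A) : P.x a ⬝ᵥ P.x a = 1 := by
  rw [dotProduct_self_eq_norm_sq, P.norm_x, one_pow]

theorem dotProduct_θ_self_le : P.θ ⬝ᵥ P.θ ≤ 1 := by
  rw [dotProduct_self_eq_norm_sq]
  exact pow_le_one₀ (norm_nonneg _) P.norm_θ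

theorem dim_ne_zero [Nonempty A] (P : Problem d A K) : d ≠ 0 := by
  rintro rfl
  have := P.dotProduct_x_self (Classical.arbitrary A)
  simp [dotProduct] at this

theorem abs_x_dotProduct_θ_le (a : A) : |P.x a ⬝ᵥ P.θ| ≤ 1 := by
  have h := dotProduct_sq_le (P.x a) P.θ
  rw [P.dotProduct_x_self, one_mul] at h
  exact abs_le_one_iff_mul_self_le_one.mpr (by nlinarith [P.dotProduct_θ_self_le])

theorem dotProduct_xt_self_le (k : K) : P.xt k ⬝ᵥ P.xt k ≤ 1 := by
  rw [dotProduct_self_eq_norm_sq]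
  refine pow_le_one₀ (norm_nonneg _) ?_
  have h : WithLp.toLp 2 (P.xt k)
      = ∑ a, (P.w a k / ∑ a', P.w a' k) • WithLp.toLp 2 (P.x a) := by
    simp [xt, keyTermVec, WithLp.toLp_sum, WithLp.toLp_smul]
  have h0 := P.sum_w_pos k
  rw [h]
  refine (norm_sum_le _ _).trans (le_of_eq ?_)
  simp_rw [norm_smul, P.norm_x, mul_one, Real.norm_eq_abs]
  rw [Finset.sum_congr rfl fun a _ => abs_of_nonneg (div_nonneg (P.w_nonneg a k) h0.le),
    ← Finset.sum_div, div_self h0.ne']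

/-- The matrix `E[x̃_k x̃_kᵀ]` for `k` uniform on `B`. -/
noncomputable def secondMoment (B : Finset K) : Matrix (Fin d) (Fin d) ℝ :=
  (B.card : ℝ)⁻¹ • ∑ k ∈ B, vecMulVec (P.xt k) (P.xt k)

theorem secondMoment_posSemidef (B : Finset K) : (P.secondMoment B).PosSemidef :=
  (posSemidef_sum _ fun k _ => posSemidef_vecMulVec_self (P.xt k)).smul (by positivity)

theorem dotProduct_secondMoment_mulVec (B : Finset K) (v : Fin d → ℝ) :
    v ⬝ᵥ P.secondMoment B *ᵥ v = (B.card : ℝ)⁻¹ * ∑ k ∈ B, (P.xt k ⬝ᵥ v) ^ 2 := by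
  simp [secondMoment, smul_mulVec, sum_mulVec, dotProduct_sum, dotProduct_vecMulVec_mulVec]

/-- A vector orthogonal to B is orthogonal to every key-term, and these span the space. -/
theorem eq_zero_of_forall_spanner {B : Finset K} (hB : P.IsBarycentricSpanner B)
    {v : Fin d → ℝ} (h : ∀ k ∈ B, P.xt k ⬝ᵥ v = 0) : v = 0 := by
  have hK : ∀ k, P.xt k ⬝ᵥ v = 0 := fun k => by
    obtain ⟨c, -, hc⟩ := hB.2 k
    rw [hc, sum_dotProduct]
    exact Finset.sum_eq_zero fun j hj => by simp [smul_dotProduct, h j hj]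
  have hv : v ∈ Submodule.span ℝ (Set.range (keyTermVec P.x P.w)) := by simp [P.span_key]
  have hall : v ⬝ᵥ v = 0 := by
    refine Submodule.span_induction (p := fun u _ => u ⬝ᵥ v = 0) ?_ (by simp) ?_ ?_ hv
    · rintro _ ⟨k, rfl⟩
      exact hK k
    · intro u w _ _ hu hw
      simp [add_dotProduct, hu, hw]
    · intro r u _ hu
      simp [smul_dotProduct, hu]
  exact dotProduct_self_eq_zero.mp hall

theorem lambdaB_mul_le (B : Finset K) (v : Fin d → ℝ) :
    P.lambdaB B * (v ⬝ᵥ v) ≤ (B.card : ℝ)⁻¹ * ∑ k ∈ B, (P.xt k ⬝ᵥ v) ^ 2 := by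
  rw [← P.dotProduct_secondMoment_mulVec]
  exact lambdaMin_mul_le (P.secondMoment_posSemidef B).isHermitian v

theorem lambdaB_pos [NeZero d] {B : Finset K} (hB : P.IsBarycentricSpanner B) :
    0 < P.lambdaB B := by
  have hM : (P.secondMoment B).PosDef := by
    refine PosDef.of_dotProduct_mulVec_pos (P.secondMoment_posSemidef B).isHermitian fun v hv => ?_
    rw [star_trivial, P.dotProduct_secondMoment_mulVec, hB.1]
    have hd : (0 : ℝ) < d := by exact_mod_cast Nat.pos_of_ne_zero (NeZero.ne d)
    refine mul_pos (inv_pos.mpr hd) ?_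
    by_contra! hle
    have h0 := (Finset.sum_nonneg fun k (_ : k ∈ B) => sq_nonneg (P.xt k ⬝ᵥ v))
    have h1 := (Finset.sum_eq_zero_iff_of_nonneg fun k (_ : k ∈ B) =>
      sq_nonneg (P.xt k ⬝ᵥ v)).mp (le_antisymm hle h0)
    exact hv (P.eq_zero_of_forall_spanner hB fun k hk => by simpa using h1 k hk)
  obtain ⟨i, hi⟩ := lambdaMin_mem_range hM.isHermitian
  have := hM.eigenvalues_pos i
  rw [hi] at this
  exact this

/-- The trace of the second moment is an average of squared norms at most 1, and it dominates d λ_B.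
-/
theorem lambdaB_le [NeZero d] {B : Finset K} (hB : P.IsBarycentricSpanner B) :
    P.lambdaB B ≤ 1 / d := by
  have hd : (0 : ℝ) < d := by exact_mod_cast Nat.pos_of_ne_zero (NeZero.ne d)
  have h := Finset.sum_le_sum fun i (_ : i ∈ (Finset.univ : Finset (Fin d))) =>
    P.lambdaB_mul_le B (Pi.single i 1)
  rw [← Finset.mul_sum, ← Finset.mul_sum, Finset.sum_comm] at h
  simp only [dotProduct_single_one, Pi.single_eq_same, Finset.sum_const,
    Finset.card_univ, Fintype.card_fin, nsmul_eq_mul, mul_one, hB.1] at h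
  have h2 : ∑ k ∈ B, ∑ i, P.xt k i ^ 2 ≤ d := by
    refine (Finset.sum_le_sum fun k _ => ?_).trans_eq (by simp [hB.1] : ∑ k ∈ B, (1 : ℝ) = _)
    simpa [dotProduct, sq] using P.dotProduct_xt_self_le k
  have h3 : (d : ℝ)⁻¹ * ∑ k ∈ B, ∑ i, P.xt k i ^ 2 ≤ 1 := by
    rw [inv_mul_le_iff₀ hd]
    linarith
  rw [le_div_iff₀ hd]
  linarith

end Problem

/-! ### Sub-Gaussian mixtures and Ville's inequality. -/

section Supermartingale

open scoped ENNReal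

variable {Ω : Type*} {m mΩ : MeasurableSpace Ω} {μ : Measure Ω}

/-- On m the measure with density f is dominated by μ, so any m-measurable Z can be integrated
against both, with no integrability condition. -/
theorem lintegral_mul_le_of_setLIntegral_le (hm : m ≤ mΩ) {f : Ω → ℝ≥0∞} (hf : Measurable f)
    (h : ∀ E, MeasurableSet[m] E → ∫⁻ ω in E, f ω ∂μ ≤ μ E) {Z : Ω → ℝ≥0∞}
    (hZ : Measurable[m] Z) : ∫⁻ ω, Z ω * f ω ∂μ ≤ ∫⁻ ω, Z ω ∂μ := by
  have hle : (μ.withDensity f).trim hm ≤ μ.trim hm := by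
    refine Measure.le_iff.mpr fun E hE => ?_
    rw [trim_measurableSet_eq hm hE, trim_measurableSet_eq hm hE, withDensity_apply _ (hm E hE)]
    exact h E hE
  calc ∫⁻ ω, Z ω * f ω ∂μ = ∫⁻ ω, Z ω ∂(μ.withDensity f) := by
        rw [lintegral_withDensity_eq_lintegral_mul _ hf (hZ.mono hm le_rfl)]
        simp [mul_comm]
    _ = ∫⁻ ω, Z ω ∂((μ.withDensity f).trim hm) := (lintegral_trim hm hZ).symm
    _ ≤ ∫⁻ ω, Z ω ∂(μ.trim hm) := lintegral_mono' hle le_rfl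
    _ = ∫⁻ ω, Z ω ∂μ := lintegral_trim hm hZ

theorem CondSubgaussianOne.lintegral_mul_exp_le [IsFiniteMeasure μ] (hm : m ≤ mΩ) {X : Ω → ℝ}
    (hX : Measurable X) (h : CondSubgaussianOne m X μ) {Z : Ω → ℝ≥0∞} (hZ : Measurable[m] Z)
    (s : ℝ) :
    ∫⁻ ω, Z ω * ENNReal.ofReal (Real.exp (s * X ω - s ^ 2 / 2)) ∂μ ≤ ∫⁻ ω, Z ω ∂μ := by
  refine lintegral_mul_le_of_setLIntegral_le hm (by fun_prop) (fun E hE => ?_) hZ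
  obtain ⟨hint, hle⟩ := h s
  have h1 : ∫ ω in E, Real.exp (s * X ω) ∂μ ≤ Real.exp (s ^ 2 / 2) * μ.real E := by
    rw [← setIntegral_condExp hm hint hE]
    calc _ ≤ ∫ ω in E, Real.exp (s ^ 2 / 2) ∂μ :=
          setIntegral_mono_ae integrable_condExp.integrableOn (by simp) hle
      _ = _ := by simp [mul_comm]
  have h2 : ∀ ω, Real.exp (s * X ω - s ^ 2 / 2) =
      (Real.exp (s ^ 2 / 2))⁻¹ * Real.exp (s * X ω) := fun ω => by
    rw [Real.exp_sub]; ring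
  simp_rw [h2]
  rw [← ofReal_integral_eq_lintegral_ofReal (hint.const_mul _).integrableOn
    (Filter.Eventually.of_forall fun ω => by positivity), integral_const_mul]
  refine ENNReal.ofReal_le_of_le_toReal ?_
  rw [inv_mul_le_iff₀ (Real.exp_pos _)]
  exact h1

/-- The exceptional null set of the conditional bound depends on the exponent, so a random exponent
is split into its level sets. Fatou's lemma then passes from finitely many values to a general
measurable exponent. -/
theorem CondSubgaussianOne.lintegral_mul_exp_le_of_finite_range [IsFiniteMeasure μ] (hm : m ≤ mΩ)
    {X : Ω → ℝ} (hX : Measurable X) (h : CondSubgaussianOne m X μ) {Z : Ω → ℝ≥0∞}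
    (hZ : Measurable[m] Z) {φ : Ω → ℝ} (hφ : Measurable[m] φ)
    (hfin : (Set.range φ).Finite) :
    ∫⁻ ω, Z ω * ENNReal.ofReal (Real.exp (φ ω * X ω - φ ω ^ 2 / 2)) ∂μ ≤ ∫⁻ ω, Z ω ∂μ := by
  have hmeas : ∀ r, MeasurableSet[m] (φ ⁻¹' {r}) := fun r =>
    hφ (measurableSet_singleton r)
  have hZr : ∀ r, Measurable[m] ((φ ⁻¹' {r}).indicator Z) := fun r => hZ.indicator (hmeas r)
  have hsum : ∀ (ω : Ω) (g : ℝ → ℝ≥0∞), Z ω * g (φ ω) =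
      ∑ r ∈ hfin.toFinset, (φ ⁻¹' {r}).indicator Z ω * g r := fun ω g => by
    rw [Finset.sum_eq_single (φ ω)]
    · simp
    · intro r _ hr
      simp [Set.indicator, Ne.symm hr]
    · intro hn
      exact absurd (by simp) hn
  have hZeq : ∀ ω, Z ω = ∑ r ∈ hfin.toFinset, (φ ⁻¹' {r}).indicator Z ω := fun ω => by
    simpa using hsum ω fun _ => 1
  calc ∫⁻ ω, Z ω * ENNReal.ofReal (Real.exp (φ ω * X ω - φ ω ^ 2 / 2)) ∂μ
      = ∫⁻ ω, ∑ r ∈ hfin.toFinset, (φ ⁻¹' {r}).indicator Z ω *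
          ENNReal.ofReal (Real.exp (r * X ω - r ^ 2 / 2)) ∂μ :=
        lintegral_congr fun ω =>
          hsum ω fun r => ENNReal.ofReal (Real.exp (r * X ω - r ^ 2 / 2))
    _ = ∑ r ∈ hfin.toFinset, ∫⁻ ω, (φ ⁻¹' {r}).indicator Z ω *
          ENNReal.ofReal (Real.exp (r * X ω - r ^ 2 / 2)) ∂μ :=
        lintegral_finsetSum _ fun r _ => ((hZr r).mono hm le_rfl).mul (by fun_prop)
    _ ≤ ∑ r ∈ hfin.toFinset, ∫⁻ ω, (φ ⁻¹' {r}).indicator Z ω ∂μ :=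
        Finset.sum_le_sum fun r _ => h.lintegral_mul_exp_le hm hX (hZr r) r
    _ = ∫⁻ ω, Z ω ∂μ := by
        rw [← lintegral_finsetSum _ fun r _ => (hZr r).mono hm le_rfl]
        exact lintegral_congr fun ω => (hZeq ω).symm

/-- The sub-Gaussian bound at an `m`-measurable random exponent. -/
theorem CondSubgaussianOne.lintegral_mul_exp_le_of_measurable [IsFiniteMeasure μ] (hm : m ≤ mΩ)
    {X : Ω → ℝ} (hX : Measurable X) (h : CondSubgaussianOne m X μ) {Z : Ω → ℝ≥0∞}
    (hZ : Measurable[m] Z) {L : Ω → ℝ} (hL : Measurable[m] L) :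
    ∫⁻ ω, Z ω * ENNReal.ofReal (Real.exp (L ω * X ω - L ω ^ 2 / 2)) ∂μ ≤ ∫⁻ ω, Z ω ∂μ := by
  have hsL : StronglyMeasurable[m] L := hL.stronglyMeasurable
  have htend : ∀ ω, Filter.Tendsto (fun n => Z ω * ENNReal.ofReal
      (Real.exp (hsL.approx n ω * X ω - hsL.approx n ω ^ 2 / 2))) Filter.atTop
      (nhds (Z ω * ENNReal.ofReal (Real.exp (L ω * X ω - L ω ^ 2 / 2)))) := fun ω => by
    refine ENNReal.Tendsto.const_mul ?_ (Or.inl (by simp [Real.exp_pos]))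
    refine ENNReal.tendsto_ofReal ?_
    have hc : Continuous fun l : ℝ => Real.exp (l * X ω - l ^ 2 / 2) := by fun_prop
    exact (hc.tendsto _).comp (hsL.tendsto_approx ω)
  calc ∫⁻ ω, Z ω * ENNReal.ofReal (Real.exp (L ω * X ω - L ω ^ 2 / 2)) ∂μ
      = ∫⁻ ω, Filter.liminf (fun n => Z ω * ENNReal.ofReal
          (Real.exp (hsL.approx n ω * X ω - hsL.approx n ω ^ 2 / 2))) Filter.atTop ∂μ :=
        lintegral_congr fun ω => (htend ω).liminf_eq.symm
    _ ≤ Filter.liminf (fun n => ∫⁻ ω, Z ω * ENNReal.ofReal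
          (Real.exp (hsL.approx n ω * X ω - hsL.approx n ω ^ 2 / 2)) ∂μ) Filter.atTop := by
        refine lintegral_liminf_le fun n => ?_
        have hφ : Measurable (hsL.approx n) :=
          (@SimpleFunc.measurable _ _ m _ (hsL.approx n)).mono hm le_rfl
        exact (hZ.mono hm le_rfl).mul (by fun_prop)
    _ ≤ ∫⁻ ω, Z ω ∂μ := by
        refine Filter.liminf_le_of_frequently_le' (Filter.Frequently.of_forall fun n => ?_)
        exact h.lintegral_mul_exp_le_of_finite_range hm hX hZ
          (@SimpleFunc.measurable _ _ m _ (hsL.approx n))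
          (@SimpleFunc.finite_range _ _ m (hsL.approx n))

/-- Completing the square leaves the density of a Gaussian with mean σ(η - p)/(1 + σ²) and variance
1/(1 + σ²). -/
theorem lintegral_exp_gaussianReal (η p σ : ℝ) :
    ∫⁻ x, ENNReal.ofReal (Real.exp ((p + σ * x) * η - (p + σ * x) ^ 2 / 2)) ∂gaussianReal 0 1 =
      ENNReal.ofReal ((√(1 + σ ^ 2))⁻¹ *
        Real.exp ((2 * η * p + σ ^ 2 * η ^ 2 - p ^ 2) / (2 * (1 + σ ^ 2)))) := by
  have hpos : 0 < 1 + σ ^ 2 := by positivity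
  let v : NNReal := ⟨(1 + σ ^ 2)⁻¹, by positivity⟩
  have hv : v ≠ 0 := by
    intro h
    have : (v : ℝ) = 0 := by rw [h]; rfl
    exact (inv_pos.mpr hpos).ne' this
  have hvc : (v : ℝ) = (1 + σ ^ 2)⁻¹ := rfl
  rw [gaussianReal_of_var_ne_zero 0 one_ne_zero,
    lintegral_withDensity_eq_lintegral_mul _ (measurable_gaussianPDF 0 1) (by fun_prop)]
  have key : ∀ x, (gaussianPDF 0 1 * fun x => ENNReal.ofReal
      (Real.exp ((p + σ * x) * η - (p + σ * x) ^ 2 / 2))) x =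
      ENNReal.ofReal ((√(1 + σ ^ 2))⁻¹ *
        Real.exp ((2 * η * p + σ ^ 2 * η ^ 2 - p ^ 2) / (2 * (1 + σ ^ 2)))) *
      ENNReal.ofReal (gaussianPDFReal (σ * (η - p) / (1 + σ ^ 2)) v x) := fun x => by
    rw [Pi.mul_apply, gaussianPDF, ← ENNReal.ofReal_mul (gaussianPDFReal_nonneg _ _ _),
      ← ENNReal.ofReal_mul (by positivity)]
    congr 1
    simp only [gaussianPDFReal, hvc, NNReal.coe_one]
    rw [mul_assoc, ← Real.exp_add, mul_mul_mul_comm, ← Real.exp_add]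
    congr 1
    · rw [← mul_inv, ← Real.sqrt_mul hpos.le]
      congr 2
      field_simp
    · congr 1
      field_simp
      ring
  rw [lintegral_congr key, lintegral_const_mul _ (by fun_prop),
    lintegral_gaussianPDFReal_eq_one _ hv, mul_one]

/-- One step of the method of mixtures for a scalar innovation. -/
theorem CondSubgaussianOne.lintegral_mul_mixture_le [IsFiniteMeasure μ] (hm : m ≤ mΩ) {X : Ω → ℝ}
    (hX : Measurable X) (h : CondSubgaussianOne m X μ) {Z : Ω → ℝ≥0∞} (hZ : Measurable[m] Z)
    {p s : Ω → ℝ} (hp : Measurable[m] p) (hs : Measurable[m] s) (hs0 : ∀ ω, 0 ≤ s ω) :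
    ∫⁻ ω, Z ω * ENNReal.ofReal ((√(1 + s ω))⁻¹ *
      Real.exp ((2 * X ω * p ω + s ω * X ω ^ 2 - p ω ^ 2) / (2 * (1 + s ω)))) ∂μ ≤
      ∫⁻ ω, Z ω ∂μ := by
  have hp' := hp.mono hm le_rfl
  have hs' := hs.mono hm le_rfl
  have hZ' := hZ.mono hm le_rfl
  -- The factor is the average over x of the exponential at the m-measurable exponent p + √s x;
  -- Tonelli then allows x to be frozen.
  have key : ∀ ω, Z ω * ENNReal.ofReal ((√(1 + s ω))⁻¹ *
      Real.exp ((2 * X ω * p ω + s ω * X ω ^ 2 - p ω ^ 2) / (2 * (1 + s ω)))) =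
      ∫⁻ x, Z ω * ENNReal.ofReal (Real.exp ((p ω + √(s ω) * x) * X ω -
        (p ω + √(s ω) * x) ^ 2 / 2)) ∂gaussianReal 0 1 := fun ω => by
    rw [lintegral_const_mul _ (by fun_prop), lintegral_exp_gaussianReal, Real.sq_sqrt (hs0 ω)]
  rw [lintegral_congr key, lintegral_lintegral_swap]
  · calc _ ≤ ∫⁻ x, (∫⁻ ω, Z ω ∂μ) ∂gaussianReal 0 1 := by
          refine lintegral_mono fun x => ?_
          exact h.lintegral_mul_exp_le_of_measurable hm hX hZ
            (hp.add ((Real.continuous_sqrt.measurable.comp hs).mul_const x))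
      _ = _ := by simp
  · refine Measurable.aemeasurable ?_
    simp only [Function.uncurry_def]
    fun_prop

/-- **Ville's inequality** over finitely many steps. -/
theorem measure_exists_le_mul_le [IsFiniteMeasure μ] {F : ℕ → MeasurableSpace Ω}
    (hF : ∀ n, F n ≤ mΩ) (hmono : Monotone F) {Y : ℕ → Ω → ℝ≥0∞} (hY : ∀ n, Measurable[F n] (Y n))
    {N : ℕ} (hstep : ∀ n < N, ∀ E, MeasurableSet[F n] E →
      ∫⁻ ω in E, Y (n + 1) ω ∂μ ≤ ∫⁻ ω in E, Y n ω ∂μ) (c : ℝ≥0∞) :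
    c * μ {ω | ∃ n ≤ N, c ≤ Y n ω} ≤ ∫⁻ ω, Y 0 ω ∂μ := by
  have hset : ∀ n, MeasurableSet[F n] {ω | ∃ k ≤ n, c ≤ Y k ω} := fun n => by
    have : {ω | ∃ k ≤ n, c ≤ Y k ω} = ⋃ k ∈ Set.Iic n, {ω | c ≤ Y k ω} := by ext; simp
    rw [this]
    refine MeasurableSet.biUnion (Set.to_countable _) fun k hk => ?_
    exact hmono hk _ (hY k measurableSet_Ici)
  -- Invariant of the stopped process: mass that has reached level c is frozen at c, the rest still
  -- evolves as Y. At each step the newly crossing part moves to the first term.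
  have key : ∀ n ≤ N, c * μ {ω | ∃ k ≤ n, c ≤ Y k ω} +
      ∫⁻ ω in {ω | ∃ k ≤ n, c ≤ Y k ω}ᶜ, Y n ω ∂μ ≤ ∫⁻ ω, Y 0 ω ∂μ := by
    intro n
    induction n with
    | zero =>
      intro _
      rw [← lintegral_add_compl (μ := μ) (Y 0) (hF 0 _ (hset 0))]
      refine add_le_add ?_ le_rfl
      rw [← setLIntegral_const]
      refine setLIntegral_mono_ae ((hY 0).mono (hF 0) le_rfl).aemeasurable ?_
      exact Filter.Eventually.of_forall fun ω ⟨k, hk, hc⟩ => by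
        rwa [Nat.le_zero.mp hk] at hc
    | succ n ih =>
      intro hn
      refine le_trans ?_ (ih (by omega))
      set G := {ω | ∃ k ≤ n, c ≤ Y k ω} with hG
      set G' := {ω | ∃ k ≤ n + 1, c ≤ Y k ω} with hG'
      have hGm : MeasurableSet G := hF n _ (hset n)
      have hGm' : MeasurableSet G' := hF _ _ (hset (n + 1))
      have hsub : G ⊆ G' := fun ω ⟨k, hk, hc⟩ => ⟨k, by omega, hc⟩
      have h1 : ∫⁻ ω in Gᶜ, Y (n + 1) ω ∂μ = ∫⁻ ω in Gᶜ ∩ G', Y (n + 1) ω ∂μ +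
          ∫⁻ ω in Gᶜ \ G', Y (n + 1) ω ∂μ := (lintegral_inter_add_sdiff _ _ hGm').symm
      have h2 : Gᶜ \ G' = G'ᶜ := by
        ext ω
        simp only [Set.mem_sdiff, Set.mem_compl_iff]
        exact ⟨fun h => h.2, fun h => ⟨fun hg => h (hsub hg), h⟩⟩
      have h3 : c * μ (Gᶜ ∩ G') ≤ ∫⁻ ω in Gᶜ ∩ G', Y (n + 1) ω ∂μ := by
        rw [← setLIntegral_const]
        refine setLIntegral_mono_ae ((hY _).mono (hF _) le_rfl).aemeasurable ?_
        refine Filter.Eventually.of_forall fun ω ⟨hω, k, hk, hc⟩ => ?_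
        rcases Nat.lt_or_ge n k with hlt | hle
        · rwa [show k = n + 1 by omega] at hc
        · exact absurd ⟨k, hle, hc⟩ hω
      have h4 : μ G' = μ G + μ (Gᶜ ∩ G') := by
        rw [← measure_inter_add_sdiff G' hGm, Set.inter_eq_right.mpr hsub, Set.sdiff_eq,
          Set.inter_comm]
      have h5 := hstep n (by omega) Gᶜ (hset n).compl
      rw [h1, h2] at h5
      rw [h4, mul_add, add_assoc]
      gcongr
      exact le_trans (by gcongr) h5
  exact le_trans le_self_add (key N le_rfl)

end Supermartingale

/-! ### Measurability of determinants, inverses and quadratic forms. -/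

section MatrixMeasurability

variable {Ω : Type*} {m : MeasurableSpace Ω} {d : ℕ}

theorem measurable_det_of_entries {M : Ω → Matrix (Fin d) (Fin d) ℝ}
    (hM : ∀ i j, Measurable fun ω => M ω i j) : Measurable fun ω => (M ω).det := by
  simp only [Matrix.det_apply]
  refine Finset.measurable_fun_sum _ fun σ _ => ?_
  exact (Finset.measurable_fun_prod _ fun i _ => hM _ _).const_smul _

/-- Cramer's formula; singular matrices do no harm, as the inverse is then the default 0. -/
theorem measurable_inv_of_entries {M : Ω → Matrix (Fin d) (Fin d) ℝ}
    (hM : ∀ i j, Measurable fun ω => M ω i j) (i j : Fin d) :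
    Measurable fun ω => (M ω)⁻¹ i j := by
  simp only [Matrix.inv_def, Ring.inverse_eq_inv', Matrix.smul_apply, adjugate_apply, smul_eq_mul]
  refine (measurable_det_of_entries hM).inv.mul (measurable_det_of_entries fun k l => ?_)
  simp only [updateRow_apply]
  split_ifs
  · exact measurable_const
  · exact hM k l

theorem measurable_dotProduct_mulVec {M : Ω → Matrix (Fin d) (Fin d) ℝ} {u v : Ω → Fin d → ℝ}
    (hM : ∀ i j, Measurable fun ω => M ω i j) (hu : ∀ i, Measurable fun ω => u ω i)
    (hv : ∀ i, Measurable fun ω => v ω i) : Measurable fun ω => u ω ⬝ᵥ M ω *ᵥ v ω := by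
  simp only [dotProduct, mulVec]
  exact Finset.measurable_fun_sum _ fun i _ => (hu i).mul <|
    Finset.measurable_fun_sum _ fun j _ => (hM i j).mul (hv j)

end MatrixMeasurability

/-! ### The filtration generated by the observations. -/

namespace Interaction

section History

variable {d : ℕ} {Ω A K : Type*} [Fintype A] [Fintype K] [MeasurableSpace A] [MeasurableSpace K]
  (I : Interaction Ω A K) (P : Problem d A K) (b : ℝ)

theorem comap_arm_sup_le_history {t i τ : ℕ} (h1 : 1 ≤ τ) (h2 : τ < t) :
    MeasurableSpace.comap (I.arm τ) inferInstance ⊔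
      MeasurableSpace.comap (I.reward P τ) inferInstance ≤ I.history P b t i :=
  le_sup_of_le_left <| le_sup_of_le_left <|
    le_iSup₂_of_le τ (Finset.mem_Ico.mpr ⟨h1, h2⟩) le_rfl

theorem comap_key_sup_le_history {t i τ j : ℕ} (h1 : 1 ≤ τ) (h2 : τ < t) (hj : j < queries b τ) :
    MeasurableSpace.comap (I.key τ j) inferInstance ⊔
      MeasurableSpace.comap (I.feedback P τ j) inferInstance ≤ I.history P b t i :=
  le_sup_of_le_left <| le_sup_of_le_right <|
    le_iSup₂_of_le τ (Finset.mem_Ico.mpr ⟨h1, h2⟩) <|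
      le_iSup₂_of_le j (Finset.mem_range.mpr hj) le_rfl

theorem comap_key_sup_le_history_self {t i j : ℕ} (hj : j < i) :
    MeasurableSpace.comap (I.key t j) inferInstance ⊔
      MeasurableSpace.comap (I.feedback P t j) inferInstance ≤ I.history P b t i :=
  le_sup_of_le_right <| le_iSup₂_of_le j (Finset.mem_range.mpr hj) le_rfl

theorem history_le_of {m : MeasurableSpace Ω} {t i : ℕ}
    (h1 : ∀ τ, 1 ≤ τ → τ < t → MeasurableSpace.comap (I.arm τ) inferInstance ⊔
      MeasurableSpace.comap (I.reward P τ) inferInstance ≤ m)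
    (h2 : ∀ τ, 1 ≤ τ → τ < t → ∀ j < queries b τ, MeasurableSpace.comap (I.key τ j) inferInstance ⊔
      MeasurableSpace.comap (I.feedback P τ j) inferInstance ≤ m)
    (h3 : ∀ j < i, MeasurableSpace.comap (I.key t j) inferInstance ⊔
      MeasurableSpace.comap (I.feedback P t j) inferInstance ≤ m) :
    I.history P b t i ≤ m := by
  refine sup_le (sup_le ?_ ?_) ?_
  · exact iSup₂_le fun τ hτ => h1 τ (Finset.mem_Ico.mp hτ).1 (Finset.mem_Ico.mp hτ).2
  · exact iSup₂_le fun τ hτ => iSup₂_le fun j hj =>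
      h2 τ (Finset.mem_Ico.mp hτ).1 (Finset.mem_Ico.mp hτ).2 j (Finset.mem_range.mp hj)
  · exact iSup₂_le fun j hj => h3 j (Finset.mem_range.mp hj)

theorem history_mono_right {t i j : ℕ} (hij : i ≤ j) : I.history P b t i ≤ I.history P b t j :=
  I.history_le_of P b (fun _ h1 h2 => I.comap_arm_sup_le_history P b h1 h2)
    (fun _ h1 h2 _ hj => I.comap_key_sup_le_history P b h1 h2 hj)
    (fun _ hj => I.comap_key_sup_le_history_self P b (by omega))

theorem history_le_succ {t i : ℕ} (ht : 1 ≤ t) :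
    I.history P b t (queries b t) ≤ I.history P b (t + 1) i :=
  I.history_le_of P b (fun _ h1 h2 => I.comap_arm_sup_le_history P b h1 (by omega))
    (fun _ h1 h2 _ hj => I.comap_key_sup_le_history P b h1 (by omega) hj)
    (fun _ hj => I.comap_key_sup_le_history P b ht (by omega) hj)

theorem measurable_arm_history {t i τ : ℕ} (h1 : 1 ≤ τ) (h2 : τ < t) :
    Measurable[I.history P b t i] (I.arm τ) :=
  measurable_iff_comap_le.mpr (le_sup_left.trans (I.comap_arm_sup_le_history P b h1 h2))

theorem measurable_key_history {t i τ j : ℕ} (h1 : 1 ≤ τ) (h2 : τ < t) (hj : j < queries b τ) :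
    Measurable[I.history P b t i] (I.key τ j) :=
  measurable_iff_comap_le.mpr (le_sup_left.trans (I.comap_key_sup_le_history P b h1 h2 hj))

theorem measurable_key_history_self {t i j : ℕ} (hj : j < i) :
    Measurable[I.history P b t i] (I.key t j) :=
  measurable_iff_comap_le.mpr (le_sup_left.trans (I.comap_key_sup_le_history_self P b hj))

/-- The history records rewards, not noise; subtracting the mean, a function of the recorded arm,
recovers the noise. -/
theorem measurable_noise_history [DiscreteMeasurableSpace A] {t i τ : ℕ} (h1 : 1 ≤ τ) (h2 : τ < t) :
    Measurable[I.history P b t i] (I.noise τ) := by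
  have hr : Measurable[I.history P b t i] (I.reward P τ) :=
    measurable_iff_comap_le.mpr (le_sup_right.trans (I.comap_arm_sup_le_history P b h1 h2))
  have ha : Measurable[I.history P b t i] fun ω => P.x (I.arm τ ω) ⬝ᵥ P.θ :=
    (Measurable.of_discrete (f := fun a => P.x a ⬝ᵥ P.θ)).comp
      (I.measurable_arm_history P b h1 h2)
  have h : I.noise τ = fun ω => I.reward P τ ω - P.x (I.arm τ ω) ⬝ᵥ P.θ := by
    ext ω; simp [reward]
  rw [h]
  exact hr.sub ha

omit [MeasurableSpace A] in
theorem measurable_keyNoise_of [DiscreteMeasurableSpace K] {m : MeasurableSpace Ω} {τ j : ℕ}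
    (h : MeasurableSpace.comap (I.key τ j) inferInstance ⊔
      MeasurableSpace.comap (I.feedback P τ j) inferInstance ≤ m) :
    Measurable[m] (I.keyNoise τ j) := by
  have hr : Measurable[m] (I.feedback P τ j) :=
    measurable_iff_comap_le.mpr (le_sup_right.trans h)
  have ha : Measurable[m] fun ω => P.xt (I.key τ j ω) ⬝ᵥ P.θ :=
    (Measurable.of_discrete (f := fun a => P.xt a ⬝ᵥ P.θ)).comp
      (measurable_iff_comap_le.mpr (le_sup_left.trans h))
  have h : I.keyNoise τ j = fun ω => I.feedback P τ j ω - P.xt (I.key τ j ω) ⬝ᵥ P.θ := by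
    ext ω; simp [feedback]
  rw [h]
  exact hr.sub ha

end History

end Interaction

/-! ### Ville's inequality on the two-level clock of conversations and pulls. -/

namespace IsConLinUCBBS

open scoped ENNReal

variable {d : ℕ} {Ω A K : Type*} [Fintype A] [Fintype K] [MeasurableSpace A]
  [DiscreteMeasurableSpace A] [MeasurableSpace K] [DiscreteMeasurableSpace K]
  {mΩ : MeasurableSpace Ω} {μ : Measure Ω} {P : Problem d A K} {B : Finset K} {b β δ : ℝ} {T : ℕ}
  {I : Interaction Ω A K}

theorem history_le (hI : IsConLinUCBBS μ P B b β δ T I) (t i : ℕ) : I.history P b t i ≤ mΩ := by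
  have hkey : ∀ τ j, MeasurableSpace.comap (I.key τ j) inferInstance ⊔
      MeasurableSpace.comap (I.feedback P τ j) inferInstance ≤ mΩ := fun τ j =>
    sup_le (hI.measurable_key τ j).comap_le (Measurable.comap_le
      (((Measurable.of_discrete (f := fun k => P.xt k ⬝ᵥ P.θ)).comp
        (hI.measurable_key τ j)).add (hI.measurable_keyNoise τ j)))
  refine I.history_le_of P b (fun τ _ _ => ?_) (fun τ _ _ j _ => hkey τ j) fun j _ => hkey t j
  exact sup_le (hI.measurable_arm τ).comap_le (Measurable.comap_le
      (((Measurable.of_discrete (f := fun a => P.x a ⬝ᵥ P.θ)).comp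
        (hI.measurable_arm τ)).add (hI.measurable_noise τ)))

/-- Ville's inequality along the interaction, for a process that is a supermartingale at every
conversation and at every pull. -/
theorem measure_exists_le_mul_le [IsFiniteMeasure μ] (hI : IsConLinUCBBS μ P B b β δ T I)
    {Y : ℕ → ℕ → Ω → ℝ≥0∞} (hY : ∀ t i, i ≤ queries b t → Measurable[I.history P b t i] (Y t i))
    (hkey : ∀ t ∈ Finset.Icc 1 T, ∀ i < queries b t, ∀ E, MeasurableSet[I.history P b t i] E →
      ∫⁻ ω in E, Y t (i + 1) ω ∂μ ≤ ∫⁻ ω in E, Y t i ω ∂μ)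
    (harm : ∀ t ∈ Finset.Icc 1 T, ∀ E, MeasurableSet[I.history P b t (queries b t)] E →
      ∫⁻ ω in E, Y (t + 1) 0 ω ∂μ ≤ ∫⁻ ω in E, Y t (queries b t) ω ∂μ) (c : ℝ≥0∞) :
    c * μ {ω | ∃ t ∈ Finset.Icc 1 T, c ≤ Y t (queries b t) ω} ≤ ∫⁻ ω, Y 1 0 ω ∂μ := by
  rcases Nat.eq_zero_or_pos T with rfl | hT
  · simp
  have hround : ∀ t ∈ Finset.Icc 1 T, ∀ E, MeasurableSet[I.history P b t 0] E →
      ∀ i ≤ queries b t, ∫⁻ ω in E, Y t i ω ∂μ ≤ ∫⁻ ω in E, Y t 0 ω ∂μ := by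
    intro t ht E hE i
    induction i with
    | zero => intro _; exact le_rfl
    | succ i ih =>
      intro hi
      exact (hkey t ht i (by omega) E (I.history_mono_right P b (Nat.zero_le i) _ hE)).trans
        (ih (by omega))
  -- The one-parameter process is sampled just before each pull; index n stands for round n + 1, so
  -- T rounds make T - 1 steps.
  have hmain := ConvBandit.measure_exists_le_mul_le (μ := μ)
    (F := fun n => I.history P b (n + 1) (queries b (n + 1)))
    (fun n => hI.history_le _ _) (monotone_nat_of_le_succ fun n => I.history_le_succ P b (by omega))
    (Y := fun n => Y (n + 1) (queries b (n + 1))) (fun n => hY _ _ le_rfl) (N := T - 1)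
    (fun n hn E hE => (hround (n + 2) (by simp; omega) E
      (I.history_le_succ P b (by omega) _ hE) _ le_rfl).trans
        (harm (n + 1) (by simp; omega) E hE)) c
  have hset : {ω | ∃ t ∈ Finset.Icc 1 T, c ≤ Y t (queries b t) ω} =
      {ω | ∃ n ≤ T - 1, c ≤ Y (n + 1) (queries b (n + 1)) ω} := by
    ext ω
    constructor
    · rintro ⟨t, ht, h⟩
      obtain ⟨n, rfl⟩ : ∃ n, t = n + 1 := ⟨t - 1, by simp at ht; omega⟩
      exact ⟨n, by simp at ht; omega, h⟩
    · rintro ⟨n, hn, h⟩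
      exact ⟨n + 1, by simp; omega, h⟩
  rw [hset]
  refine hmain.trans ?_
  simpa using hround 1 (by simp; omega) Set.univ MeasurableSet.univ _ le_rfl

end IsConLinUCBBS

/-! ### Gram matrix and noise sum as they grow by one observation. -/

namespace Interaction

section PartialSums

variable {d : ℕ} {Ω A K : Type*} [Fintype A] [Fintype K]
  (I : Interaction Ω A K) (P : Problem d A K) (b β : ℝ)

/-- The regularised Gram matrix after the pulls before round `t`, the conversations before round
`t` and the first `i` conversations of round `t`. -/
noncomputable def gramAt (t i : ℕ) (ω : Ω) : Matrix (Fin d) (Fin d) ℝ :=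
  (∑ τ ∈ Finset.Ico 1 t, vecMulVec (P.x (I.arm τ ω)) (P.x (I.arm τ ω))) +
    (∑ τ ∈ Finset.Ico 1 t, ∑ j ∈ Finset.range (queries b τ),
      vecMulVec (P.xt (I.key τ j ω)) (P.xt (I.key τ j ω))) +
    (∑ j ∈ Finset.range i, vecMulVec (P.xt (I.key t j ω)) (P.xt (I.key t j ω))) +
    β • (1 : Matrix (Fin d) (Fin d) ℝ)

/-- The noise part of the least-squares target, at the same instant as `gramAt`. -/
noncomputable def noiseAt (t i : ℕ) (ω : Ω) : Fin d → ℝ :=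
  (∑ τ ∈ Finset.Ico 1 t, I.noise τ ω • P.x (I.arm τ ω)) +
    (∑ τ ∈ Finset.Ico 1 t, ∑ j ∈ Finset.range (queries b τ),
      I.keyNoise τ j ω • P.xt (I.key τ j ω)) +
    ∑ j ∈ Finset.range i, I.keyNoise t j ω • P.xt (I.key t j ω)

theorem gramAt_one_zero (ω : Ω) : I.gramAt P b β 1 0 ω = β • 1 := by simp [gramAt]

theorem noiseAt_one_zero (ω : Ω) : I.noiseAt P b 1 0 ω = 0 := by simp [noiseAt]

theorem gramAt_succ_right (t i : ℕ) (ω : Ω) : I.gramAt P b β t (i + 1) ω =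
    I.gramAt P b β t i ω + vecMulVec (P.xt (I.key t i ω)) (P.xt (I.key t i ω)) := by
  simp only [gramAt, Finset.sum_range_succ]
  abel

theorem noiseAt_succ_right (t i : ℕ) (ω : Ω) : I.noiseAt P b t (i + 1) ω =
    I.noiseAt P b t i ω + I.keyNoise t i ω • P.xt (I.key t i ω) := by
  simp only [noiseAt, Finset.sum_range_succ]
  abel

theorem gramAt_succ_left {t : ℕ} (ht : 1 ≤ t) (ω : Ω) : I.gramAt P b β (t + 1) 0 ω =
    I.gramAt P b β t (queries b t) ω + vecMulVec (P.x (I.arm t ω)) (P.x (I.arm t ω)) := by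
  simp only [gramAt, Finset.sum_Ico_succ_top ht, Finset.range_zero, Finset.sum_empty]
  abel

theorem noiseAt_succ_left {t : ℕ} (ht : 1 ≤ t) (ω : Ω) : I.noiseAt P b (t + 1) 0 ω =
    I.noiseAt P b t (queries b t) ω + I.noise t ω • P.x (I.arm t ω) := by
  simp only [noiseAt, Finset.sum_Ico_succ_top ht, Finset.range_zero, Finset.sum_empty]
  abel

theorem sum_Icc_one_eq {M : Type*} [AddCommMonoid M] {t : ℕ} (ht : 1 ≤ t) (f : ℕ → M) :
    ∑ τ ∈ Finset.Icc 1 t, f τ = ∑ τ ∈ Finset.Ico 1 t, f τ + f t := by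
  rw [← Finset.sum_Ico_succ_top ht]
  rfl

theorem gram_eq_gramAt {t : ℕ} (ht : 1 ≤ t) (ω : Ω) :
    I.gram P b β t ω = I.gramAt P b β t (queries b t) ω := by
  simp only [gram, gramAt, sum_Icc_one_eq ht]
  abel

/-- The signal part of the observations sums to the unregularised Gram matrix applied to θ. -/
theorem target_eq {t : ℕ} (ht : 1 ≤ t) (ω : Ω) : I.target P b t ω =
    (I.gram P b β t ω - β • 1) *ᵥ P.θ + I.noiseAt P b t (queries b t) ω := by
  simp only [target, gram, noiseAt, sum_Icc_one_eq ht, add_sub_cancel_right, add_mulVec,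
    sum_mulVec, vecMulVec_mulVec, reward, feedback, add_smul, Finset.sum_add_distrib,
    op_smul_eq_smul]
  abel

theorem gramAt_posDef (hβ : 0 < β) (t i : ℕ) (ω : Ω) : (I.gramAt P b β t i ω).PosDef := by
  refine PosDef.posSemidef_add (PosSemidef.add (PosSemidef.add ?_ ?_) ?_) (PosDef.one.smul hβ)
  · exact posSemidef_sum _ fun _ _ => posSemidef_vecMulVec_self _
  · exact posSemidef_sum _ fun _ _ => posSemidef_sum _ fun _ _ => posSemidef_vecMulVec_self _
  · exact posSemidef_sum _ fun _ _ => posSemidef_vecMulVec_self _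

section Measurability

variable [MeasurableSpace A] [DiscreteMeasurableSpace A] [MeasurableSpace K]
  [DiscreteMeasurableSpace K]

theorem measurable_gramAt (t i : ℕ) (k l : Fin d) :
    Measurable[I.history P b t i] fun ω => I.gramAt P b β t i ω k l := by
  simp only [gramAt, Matrix.add_apply, Matrix.sum_apply]
  refine (((Finset.measurable_fun_sum _ fun τ hτ => ?_).add (Finset.measurable_fun_sum _ fun τ hτ =>
    Finset.measurable_fun_sum _ fun j hj => ?_)).add
    (Finset.measurable_fun_sum _ fun j hj => ?_)).add measurable_const
  · rw [Finset.mem_Ico] at hτ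
    exact (Measurable.of_discrete (f := fun a => vecMulVec (P.x a) (P.x a) k l)).comp
      (I.measurable_arm_history P b hτ.1 hτ.2)
  · rw [Finset.mem_Ico] at hτ
    exact (Measurable.of_discrete (f := fun a => vecMulVec (P.xt a) (P.xt a) k l)).comp
      (I.measurable_key_history P b hτ.1 hτ.2 (Finset.mem_range.mp hj))
  · exact (Measurable.of_discrete (f := fun a => vecMulVec (P.xt a) (P.xt a) k l)).comp
      (I.measurable_key_history_self P b (Finset.mem_range.mp hj))

theorem measurable_noiseAt (t i : ℕ) (k : Fin d) :
    Measurable[I.history P b t i] fun ω => I.noiseAt P b t i ω k := by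
  simp only [noiseAt, Pi.add_apply, Finset.sum_apply, Pi.smul_apply, smul_eq_mul]
  refine ((Finset.measurable_fun_sum _ fun τ hτ => ?_).add (Finset.measurable_fun_sum _ fun τ hτ =>
    Finset.measurable_fun_sum _ fun j hj => ?_)).add
    (Finset.measurable_fun_sum _ fun j hj => ?_)
  · rw [Finset.mem_Ico] at hτ
    exact (I.measurable_noise_history P b hτ.1 hτ.2).mul
      ((Measurable.of_discrete (f := fun a => P.x a k)).comp
        (I.measurable_arm_history P b hτ.1 hτ.2))
  · rw [Finset.mem_Ico] at hτ
    exact (I.measurable_keyNoise_of P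
      (I.comap_key_sup_le_history P b hτ.1 hτ.2 (Finset.mem_range.mp hj))).mul
      ((Measurable.of_discrete (f := fun a => P.xt a k)).comp
        (I.measurable_key_history P b hτ.1 hτ.2 (Finset.mem_range.mp hj)))
  · exact (I.measurable_keyNoise_of P
      (I.comap_key_sup_le_history_self P b (Finset.mem_range.mp hj))).mul
      ((Measurable.of_discrete (f := fun a => P.xt a k)).comp
        (I.measurable_key_history_self P b (Finset.mem_range.mp hj)))

end Measurability

end PartialSums

end Interaction

/-! ### The self-normalised supermartingale. -/

section Mixture

open scoped ENNReal

variable {d : ℕ}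

/-- The Gaussian mixture of the exponential supermartingales with Gram matrix `M` and noise sum
`S`, up to normalisation. -/
noncomputable def mixture (M : Matrix (Fin d) (Fin d) ℝ) (S : Fin d → ℝ) : ℝ≥0∞ :=
  ENNReal.ofReal ((√M.det)⁻¹ * Real.exp (S ⬝ᵥ M⁻¹ *ᵥ S / 2))

/-- The determinant lemma gives the prefactor and Sherman–Morrison the exponent: exactly the factor
of the scalar mixture step. -/
theorem mixture_rankOneUpdate {M : Matrix (Fin d) (Fin d) ℝ} (hM : M.PosDef)
    (S v : Fin d → ℝ) (η : ℝ) :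
    mixture (M + vecMulVec v v) (S + η • v) = mixture M S *
      ENNReal.ofReal ((√(1 + v ⬝ᵥ M⁻¹ *ᵥ v))⁻¹ * Real.exp ((2 * η * (v ⬝ᵥ M⁻¹ *ᵥ S) +
        (v ⬝ᵥ M⁻¹ *ᵥ v) * η ^ 2 - (v ⬝ᵥ M⁻¹ *ᵥ S) ^ 2) / (2 * (1 + v ⬝ᵥ M⁻¹ *ᵥ v)))) := by
  rw [mixture, mixture, ← ENNReal.ofReal_mul (by positivity), det_add_vecMulVec hM,
    quadForm_rankOneUpdate hM, Real.sqrt_mul hM.det_pos.le, mul_inv, mul_mul_mul_comm,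
    ← Real.exp_add]
  congr 3
  rw [add_div, div_div, mul_comm (1 + _) 2]

variable {Ω : Type*} {m mΩ : MeasurableSpace Ω} {μ : Measure Ω}

theorem measurable_mixture {M : Ω → Matrix (Fin d) (Fin d) ℝ} {S : Ω → Fin d → ℝ}
    (hM : ∀ i j, Measurable fun ω => M ω i j) (hS : ∀ i, Measurable fun ω => S ω i) :
    Measurable fun ω => mixture (M ω) (S ω) := by
  have h1 := measurable_det_of_entries hM
  have h2 := measurable_dotProduct_mulVec (measurable_inv_of_entries hM) hS hS
  unfold mixture
  fun_prop

/-- The scalar mixture step with the indicator of E absorbed into the weight Z. -/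
theorem CondSubgaussianOne.setLIntegral_mixture_le [IsFiniteMeasure μ] (hm : m ≤ mΩ) {X : Ω → ℝ}
    (hX : Measurable X) (h : CondSubgaussianOne m X μ) {M : Ω → Matrix (Fin d) (Fin d) ℝ}
    {S v : Ω → Fin d → ℝ} (hMpos : ∀ ω, (M ω).PosDef)
    (hM : ∀ i j, Measurable[m] fun ω => M ω i j) (hS : ∀ i, Measurable[m] fun ω => S ω i)
    (hv : ∀ i, Measurable[m] fun ω => v ω i) {E : Set Ω} (hE : MeasurableSet[m] E) :
    ∫⁻ ω in E, mixture (M ω + vecMulVec (v ω) (v ω)) (S ω + X ω • v ω) ∂μ ≤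
      ∫⁻ ω in E, mixture (M ω) (S ω) ∂μ := by
  have hinv := measurable_inv_of_entries hM
  have hmain := h.lintegral_mul_mixture_le hm hX
    ((measurable_mixture hM hS).indicator hE) (measurable_dotProduct_mulVec hinv hv hS)
    (measurable_dotProduct_mulVec hinv hv hv)
    fun ω => by simpa using (hMpos ω).inv.posSemidef.dotProduct_mulVec_nonneg (v ω)
  rw [lintegral_indicator (hm _ hE)] at hmain
  rw [← lintegral_indicator (hm _ hE)]
  refine le_trans (le_of_eq (lintegral_congr fun ω => ?_)) hmain
  by_cases hω : ω ∈ E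
  · simp only [Set.indicator_of_mem hω]
    exact mixture_rankOneUpdate (hMpos ω) _ _ _
  · simp [Set.indicator_of_notMem hω]

end Mixture

namespace IsConLinUCBBS

open scoped ENNReal

variable {d : ℕ} {Ω A K : Type*} [Fintype A] [Fintype K] [MeasurableSpace A]
  [DiscreteMeasurableSpace A] [MeasurableSpace K] [DiscreteMeasurableSpace K]
  {mΩ : MeasurableSpace Ω} {μ : Measure Ω} {P : Problem d A K} {B : Finset K} {b β δ : ℝ} {T : ℕ}
  {I : Interaction Ω A K}

/-- The self-normalised tail bound, uniformly over the rounds. -/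
theorem measure_exists_mixture_le [IsProbabilityMeasure μ] (hI : IsConLinUCBBS μ P B b β δ T I)
    (hβ : 0 < β) {ε : ℝ} (hε : 0 < ε) :
    μ {ω | ∃ t ∈ Finset.Icc 1 T, ENNReal.ofReal (1 / ε * (√(β ^ d))⁻¹) ≤
      mixture (I.gram P b β t ω) (I.noiseAt P b t (queries b t) ω)} ≤ ENNReal.ofReal ε := by
  -- The direction of an update is known once the key-term or arm just chosen is adjoined to the
  -- history, and the noise is sub-Gaussian given exactly that σ-algebra. The available sets never
  -- enter.
  have hmeasKey : ∀ t i, ∀ k, Measurable[I.history P b t i ⊔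
      MeasurableSpace.comap (I.key t i) inferInstance] fun ω => P.xt (I.key t i ω) k :=
    fun t i k => (Measurable.of_discrete (f := fun a => P.xt a k)).comp
      (measurable_iff_comap_le.mpr le_sup_right)
  have hmeasArm : ∀ t i, ∀ k, Measurable[I.history P b t i ⊔
      MeasurableSpace.comap (I.arm t) inferInstance] fun ω => P.x (I.arm t ω) k :=
    fun t i k => (Measurable.of_discrete (f := fun a => P.x a k)).comp
      (measurable_iff_comap_le.mpr le_sup_right)
  have h := hI.measure_exists_le_mul_le
    (Y := fun t i ω => mixture (I.gramAt P b β t i ω) (I.noiseAt P b t i ω))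
    (fun t i _ => measurable_mixture (I.measurable_gramAt P b β t i) (I.measurable_noiseAt P b t i))
    (fun t ht i hi E hE => by
      simp only [I.gramAt_succ_right, I.noiseAt_succ_right]
      exact (hI.keyNoise_subgaussian t ht i hi).setLIntegral_mixture_le
        (sup_le (hI.history_le t i) (hI.measurable_key t i).comap_le) (hI.measurable_keyNoise t i)
        (I.gramAt_posDef P b β hβ t i)
        (fun k l => (I.measurable_gramAt P b β t i k l).mono le_sup_left le_rfl)
        (fun k => (I.measurable_noiseAt P b t i k).mono le_sup_left le_rfl)
        (hmeasKey t i) (le_sup_left (a := I.history P b t i) _ hE))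
    (fun t ht E hE => by
      have ht1 := (Finset.mem_Icc.mp ht).1
      simp only [I.gramAt_succ_left P b β ht1, I.noiseAt_succ_left P b ht1]
      exact (hI.noise_subgaussian t ht).setLIntegral_mixture_le
        (sup_le (hI.history_le t _) (hI.measurable_arm t).comap_le) (hI.measurable_noise t)
        (I.gramAt_posDef P b β hβ t _)
        (fun k l => (I.measurable_gramAt P b β t _ k l).mono le_sup_left le_rfl)
        (fun k => (I.measurable_noiseAt P b t _ k).mono le_sup_left le_rfl)
        (hmeasArm t _) (le_sup_left (a := I.history P b t _) _ hE))
    (ENNReal.ofReal (1 / ε * (√(β ^ d))⁻¹))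
  have hset : {ω | ∃ t ∈ Finset.Icc 1 T, ENNReal.ofReal (1 / ε * (√(β ^ d))⁻¹) ≤
      mixture (I.gram P b β t ω) (I.noiseAt P b t (queries b t) ω)} =
      {ω | ∃ t ∈ Finset.Icc 1 T, ENNReal.ofReal (1 / ε * (√(β ^ d))⁻¹) ≤
      mixture (I.gramAt P b β t (queries b t) ω) (I.noiseAt P b t (queries b t) ω)} := by
    ext ω
    refine exists_congr fun t => and_congr_right fun ht => ?_
    rw [I.gram_eq_gramAt P b β (Finset.mem_Icc.mp ht).1]
  rw [hset]
  set G := {ω | ∃ t ∈ Finset.Icc 1 T, ENNReal.ofReal (1 / ε * (√(β ^ d))⁻¹) ≤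
      mixture (I.gramAt P b β t (queries b t) ω) (I.noiseAt P b t (queries b t) ω)}
  -- At the start M = βI and S = 0, whence the normalisation β^(-d/2) of the threshold.
  have h0 : ∀ ω, mixture (I.gramAt P b β 1 0 ω) (I.noiseAt P b 1 0 ω) =
      ENNReal.ofReal (√(β ^ d))⁻¹ := fun ω => by
    simp [mixture, I.gramAt_one_zero, I.noiseAt_one_zero]
  simp only [h0, lintegral_const, measure_univ, mul_one] at h
  have hc : 0 < (√(β ^ d))⁻¹ := by positivity
  have hc' : 0 < 1 / ε * (√(β ^ d))⁻¹ := by positivity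
  rw [mul_comm] at h
  refine (ENNReal.le_div_iff_mul_le (Or.inl (by simpa using hc')) (Or.inl (by simp))).mpr h
    |>.trans_eq ?_
  rw [← ENNReal.ofReal_div_of_pos hc']
  congr 1
  field_simp

end IsConLinUCBBS

/-! ### Conversation budget, confidence width and the regret of one round. -/

theorem sum_queries {b : ℝ} (hb : 0 ≤ b) (t : ℕ) :
    ∑ τ ∈ Finset.Icc 1 t, queries b τ = ⌊b * t⌋₊ := by
  induction t with
  | zero => simp
  | succ t ih =>
    rw [Finset.sum_Icc_succ_top (by omega), ih, queries]
    have h : ((t + 1 : ℕ) : ℝ) - 1 = t := by push_cast; ring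
    rw [h]
    -- The truncated subtraction in `queries` loses nothing because the floors increase.
    exact Nat.add_sub_cancel' (Nat.floor_mono (by push_cast; nlinarith))

namespace Interaction

variable {d : ℕ} {Ω A K : Type*} [Fintype A] [Fintype K]
  (I : Interaction Ω A K) (P : Problem d A K) {b β : ℝ}

/-- How often the key-term `k` has been asked up to round `t`. -/
noncomputable def keyCount (b : ℝ) (k : K) (t : ℕ) (ω : Ω) : ℝ :=
  ∑ τ ∈ Finset.Icc 1 t, ∑ i ∈ Finset.range (queries b τ),
    ({k} : Set K).indicator (fun _ => (1 : ℝ)) (I.key τ i ω)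

theorem gram_posDef (hβ : 0 < β) (t : ℕ) (ω : Ω) : (I.gram P b β t ω).PosDef := by
  refine PosDef.posSemidef_add (PosSemidef.add ?_ ?_) (PosDef.one.smul hβ)
  · exact posSemidef_sum _ fun _ _ => posSemidef_vecMulVec_self _
  · exact posSemidef_sum _ fun _ _ => posSemidef_sum _ fun _ _ => posSemidef_vecMulVec_self _

theorem dotProduct_gram_mulVec (t : ℕ) (ω : Ω) (v : Fin d → ℝ) :
    v ⬝ᵥ I.gram P b β t ω *ᵥ v = ∑ τ ∈ Finset.Ico 1 t, (P.x (I.arm τ ω) ⬝ᵥ v) ^ 2 +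
      ∑ τ ∈ Finset.Icc 1 t, ∑ i ∈ Finset.range (queries b τ), (P.xt (I.key τ i ω) ⬝ᵥ v) ^ 2 +
      β * (v ⬝ᵥ v) := by
  simp [gram, add_mulVec, smul_mulVec, sum_mulVec, dotProduct_add, dotProduct_sum,
    dotProduct_vecMulVec_mulVec]

/-- Arms, regulariser and key-terms outside B only add nonnegative terms; the remaining
conversations are grouped by key-term. -/
theorem sum_keyCount_le_dotProduct_gram_mulVec (hβ : 0 ≤ β) (B : Finset K) (t : ℕ) (ω : Ω)
    (v : Fin d → ℝ) :
    ∑ k ∈ B, I.keyCount b k t ω * (P.xt k ⬝ᵥ v) ^ 2 ≤ v ⬝ᵥ I.gram P b β t ω *ᵥ v := by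
  classical
  rw [dotProduct_gram_mulVec]
  have h1 : 0 ≤ ∑ τ ∈ Finset.Ico 1 t, (P.x (I.arm τ ω) ⬝ᵥ v) ^ 2 :=
    Finset.sum_nonneg fun _ _ => sq_nonneg _
  have h2 : 0 ≤ β * (v ⬝ᵥ v) := mul_nonneg hβ (by simpa using dotProduct_star_self_nonneg v)
  have h3 : ∑ k ∈ B, I.keyCount b k t ω * (P.xt k ⬝ᵥ v) ^ 2 ≤
      ∑ τ ∈ Finset.Icc 1 t, ∑ i ∈ Finset.range (queries b τ), (P.xt (I.key τ i ω) ⬝ᵥ v) ^ 2 := by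
    simp only [keyCount, Finset.sum_mul]
    rw [Finset.sum_comm]
    refine Finset.sum_le_sum fun τ _ => ?_
    rw [Finset.sum_comm]
    refine Finset.sum_le_sum fun i _ => ?_
    simp only [Set.indicator_apply, Set.mem_singleton_iff, ite_mul, one_mul, zero_mul,
      Finset.sum_ite_eq]
    split_ifs
    · exact le_rfl
    · positivity
  linarith

theorem mul_le_dotProduct_gram_mulVec (t : ℕ) (ω : Ω) (v : Fin d → ℝ) :
    β * (v ⬝ᵥ v) ≤ v ⬝ᵥ I.gram P b β t ω *ᵥ v := by
  rw [dotProduct_gram_mulVec]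
  have h1 : 0 ≤ ∑ τ ∈ Finset.Ico 1 t, (P.x (I.arm τ ω) ⬝ᵥ v) ^ 2 :=
    Finset.sum_nonneg fun _ _ => sq_nonneg _
  have h2 : 0 ≤ ∑ τ ∈ Finset.Icc 1 t, ∑ i ∈ Finset.range (queries b τ),
      (P.xt (I.key τ i ω) ⬝ᵥ v) ^ 2 :=
    Finset.sum_nonneg fun _ _ => Finset.sum_nonneg fun _ _ => sq_nonneg _
  linarith

theorem trace_gram_le (hb : 0 ≤ b) (t : ℕ) (ω : Ω) :
    (I.gram P b β t ω).trace ≤ t + b * t + β * d := by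
  simp only [gram, trace_add, trace_sum, trace_vecMulVec, trace_smul, trace_one, Fintype.card_fin,
    smul_eq_mul]
  have h1 : ∑ τ ∈ Finset.Ico 1 t, P.x (I.arm τ ω) ⬝ᵥ P.x (I.arm τ ω) ≤ t := by
    simp only [P.dotProduct_x_self, Finset.sum_const, Nat.card_Ico, nsmul_eq_mul, mul_one]
    exact_mod_cast Nat.sub_le t 1
  have h2 : ∑ τ ∈ Finset.Icc 1 t, ∑ i ∈ Finset.range (queries b τ),
      P.xt (I.key τ i ω) ⬝ᵥ P.xt (I.key τ i ω) ≤ b * t := by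
    calc _ ≤ ∑ τ ∈ Finset.Icc 1 t, ∑ i ∈ Finset.range (queries b τ), (1 : ℝ) :=
          Finset.sum_le_sum fun _ _ => Finset.sum_le_sum fun _ _ => P.dotProduct_xt_self_le _
      _ = (⌊b * t⌋₊ : ℝ) := by rw [← sum_queries hb]; simp
      _ ≤ b * t := Nat.floor_le (by positivity)
  linarith

/-- Logarithm of the mixture bound, with log det M controlled through the trace. -/
theorem matNorm_noiseAt_le [NeZero d] (hb : 0 ≤ b) (hβ : 0 < β) {ε : ℝ} (hε : 0 < ε) {t : ℕ} {ω : Ω}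
    (h : mixture (I.gram P b β t ω) (I.noiseAt P b t (queries b t) ω) <
      ENNReal.ofReal (1 / ε * (√(β ^ d))⁻¹)) :
    matNorm (I.gram P b β t ω)⁻¹ (I.noiseAt P b t (queries b t) ω) ≤
      √(2 * Real.log (1 / ε) + d * Real.log (1 + (t + b * t) / (β * d))) := by
  have hd : (0 : ℝ) < d := by exact_mod_cast Nat.pos_of_ne_zero (NeZero.ne d)
  have hM := I.gram_posDef P (b := b) hβ t ω
  have htr := I.trace_gram_le P (β := β) hb t ω
  refine Real.sqrt_le_sqrt ?_
  rw [mixture, ENNReal.ofReal_lt_ofReal_iff (by positivity)] at h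
  have hdet := hM.det_pos
  have hlog := Real.log_lt_log (by positivity) h
  rw [Real.log_mul (by positivity) (by positivity), Real.log_mul (by positivity) (by positivity),
    Real.log_inv, Real.log_inv, Real.log_sqrt hdet.le, Real.log_sqrt (by positivity),
    Real.log_exp, Real.log_pow] at hlog
  have hpos : (0 : ℝ) < 1 + (t + b * t) / (β * d) := by positivity
  have hld := log_det_le hM (m := β * (1 + (t + b * t) / (β * d))) (by positivity) (by
    refine htr.trans (le_of_eq ?_)
    field_simp
    ring)
  rw [Real.log_mul hβ.ne' hpos.ne'] at hld
  linarith

/-- The error splits into noise and the shrinkage bias of the regulariser. -/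
theorem dotProduct_estimate_sub (hβ : 0 < β) {t : ℕ} (ht : 1 ≤ t) (ω : Ω) (x : Fin d → ℝ) :
    x ⬝ᵥ I.estimate P b β t ω - x ⬝ᵥ P.θ =
      x ⬝ᵥ (I.gram P b β t ω)⁻¹ *ᵥ I.noiseAt P b t (queries b t) ω -
        β * (x ⬝ᵥ (I.gram P b β t ω)⁻¹ *ᵥ P.θ) := by
  have hu : IsUnit (I.gram P b β t ω).det := (I.gram_posDef P hβ t ω).det_pos.ne'.isUnit
  rw [estimate, I.target_eq P b β ht, mulVec_add, sub_mulVec, mulVec_sub, mulVec_mulVec,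
    nonsing_inv_mul _ hu, one_mulVec, smul_mulVec, one_mulVec, mulVec_smul]
  simp only [dotProduct_add, dotProduct_sub, dotProduct_smul, smul_eq_mul]
  ring

theorem abs_dotProduct_estimate_sub_le [NeZero d] (hb : 0 ≤ b) (hβ : 0 < β) {ε : ℝ} (hε : 0 < ε)
    {t : ℕ} (ht : 1 ≤ t) {ω : Ω}
    (h : mixture (I.gram P b β t ω) (I.noiseAt P b t (queries b t) ω) <
      ENNReal.ofReal (1 / ε * (√(β ^ d))⁻¹)) (x : Fin d → ℝ) :
    |x ⬝ᵥ I.estimate P b β t ω - x ⬝ᵥ P.θ| ≤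
      alpha d b β ε t * matNorm (I.gram P b β t ω)⁻¹ x := by
  have hN := (I.gram_posDef P (b := b) hβ t ω).inv.posSemidef
  have h1 := abs_dotProduct_mulVec_le hN x (I.noiseAt P b t (queries b t) ω)
  have h2 := abs_dotProduct_mulVec_le hN x P.θ
  have h3 := I.matNorm_noiseAt_le P hb hβ hε h
  -- The bias costs β |θ| / √β ≤ √β, because M ≥ βI.
  have h4 : β * matNorm (I.gram P b β t ω)⁻¹ P.θ ≤ √β := by
    have := matNorm_inv_le (I.gram_posDef P (b := b) hβ t ω) hβ
      (I.mul_le_dotProduct_gram_mulVec P t ω) P.dotProduct_θ_self_le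
    calc _ ≤ β * √(1 / β) := by gcongr
      _ = √β := by
        rw [Real.sqrt_div zero_le_one, Real.sqrt_one, mul_one_div, Real.div_sqrt]
  have hx : 0 ≤ matNorm (I.gram P b β t ω)⁻¹ x := Real.sqrt_nonneg _
  rw [I.dotProduct_estimate_sub P hβ ht]
  calc _ ≤ |x ⬝ᵥ (I.gram P b β t ω)⁻¹ *ᵥ I.noiseAt P b t (queries b t) ω| +
        β * |x ⬝ᵥ (I.gram P b β t ω)⁻¹ *ᵥ P.θ| := by
        refine (abs_sub _ _).trans_eq ?_
        rw [abs_mul, abs_of_pos hβ]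
    _ ≤ matNorm (I.gram P b β t ω)⁻¹ x * √(2 * Real.log (1 / ε) +
          d * Real.log (1 + (t + b * t) / (β * d))) +
        matNorm (I.gram P b β t ω)⁻¹ x * √β := by
        refine add_le_add (h1.trans (by gcongr)) ?_
        calc _ ≤ β * (matNorm (I.gram P b β t ω)⁻¹ x * matNorm (I.gram P b β t ω)⁻¹ P.θ) := by
              gcongr
          _ = matNorm (I.gram P b β t ω)⁻¹ x * (β * matNorm (I.gram P b β t ω)⁻¹ P.θ) := by ring
          _ ≤ _ := by gcongr
    _ = _ := by rw [alpha]; ring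

/-- Regret of round `t`. -/
noncomputable def roundRegret (t : ℕ) (ω : Ω) : ℝ :=
  sSup ((fun a => P.x a ⬝ᵥ P.θ) '' (I.avail t ω : Set A)) - P.x (I.arm t ω) ⬝ᵥ P.θ

theorem roundRegret_le_two (t : ℕ) (ω : Ω) : I.roundRegret P t ω ≤ 2 := by
  have h1 : sSup ((fun a => P.x a ⬝ᵥ P.θ) '' (I.avail t ω : Set A)) ≤ 1 := by
    -- An empty available set has supremum 0 by default, also at most 1.
    refine Real.sSup_le ?_ zero_le_one
    rintro _ ⟨a, _, rfl⟩
    exact (abs_le.mp (P.abs_x_dotProduct_θ_le a)).2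
  have h2 := (abs_le.mp (P.abs_x_dotProduct_θ_le (I.arm t ω))).1
  unfold roundRegret
  linarith

theorem regret_le_two_mul (T : ℕ) (ω : Ω) : I.regret P T ω ≤ 2 * T := by
  refine (Finset.sum_le_sum fun t _ => I.roundRegret_le_two P t ω).trans_eq ?_
  simp [mul_comm]

/-- Optimism: the index of the arm played dominates the true value of every available arm and
exceeds its own true value by at most two widths. -/
theorem roundRegret_le {ε : ℝ} {t : ℕ} {ω : Ω}
    (hconf : ∀ a, |P.x a ⬝ᵥ I.estimate P b β t ω - P.x a ⬝ᵥ P.θ| ≤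
      alpha d b β ε t * matNorm (I.gram P b β t ω)⁻¹ (P.x a))
    (hmem : I.arm t ω ∈ I.avail t ω)
    (hmax : ∀ a ∈ I.avail t ω, I.index P b β ε t ω a ≤ I.index P b β ε t ω (I.arm t ω)) :
    I.roundRegret P t ω ≤
      2 * alpha d b β ε t * matNorm (I.gram P b β t ω)⁻¹ (P.x (I.arm t ω)) := by
  have h1 := (abs_le.mp (hconf (I.arm t ω))).2
  have h2 : sSup ((fun a => P.x a ⬝ᵥ P.θ) '' (I.avail t ω : Set A)) ≤
      I.index P b β ε t ω (I.arm t ω) := by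
    refine csSup_le (Set.Nonempty.image _ ⟨_, hmem⟩) ?_
    rintro _ ⟨a, ha, rfl⟩
    refine le_trans ?_ (hmax a ha)
    have := (abs_le.mp (hconf a)).1
    unfold index
    linarith
  unfold roundRegret
  unfold index at h2
  linarith

end Interaction

/-! ### How often each key-term of the spanner is asked. -/

namespace Interaction

variable {Ω A K : Type*} (I : Interaction Ω A K)

/-- The logarithm of the exponential supermartingale that controls the number of times the
key-term `k` has been asked, when each key-term has probability `1 / n`. -/
noncomputable def keyScore (b : ℝ) (n : ℕ) (k : K) (t i : ℕ) (ω : Ω) : ℝ :=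
  (∑ τ ∈ Finset.Ico 1 t, ∑ j ∈ Finset.range (queries b τ),
    (3 / (8 * n) - ({k} : Set K).indicator (fun _ => (1 / 2 : ℝ)) (I.key τ j ω))) +
  ∑ j ∈ Finset.range i,
    (3 / (8 * n) - ({k} : Set K).indicator (fun _ => (1 / 2 : ℝ)) (I.key t j ω))

theorem keyScore_succ_right (b : ℝ) (n : ℕ) (k : K) (t i : ℕ) (ω : Ω) :
    I.keyScore b n k t (i + 1) ω = I.keyScore b n k t i ω +
      (3 / (8 * n) - ({k} : Set K).indicator (fun _ => (1 / 2 : ℝ)) (I.key t i ω)) := by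
  simp only [keyScore, Finset.sum_range_succ, add_assoc]

theorem keyScore_succ_left (b : ℝ) (n : ℕ) (k : K) {t : ℕ} (ht : 1 ≤ t) (ω : Ω) :
    I.keyScore b n k (t + 1) 0 ω = I.keyScore b n k t (queries b t) ω := by
  simp only [keyScore, Finset.sum_Ico_succ_top ht, Finset.range_zero, Finset.sum_empty, add_zero]

theorem keyScore_queries {b : ℝ} (hb : 0 ≤ b) (n : ℕ) (k : K) {t : ℕ} (ht : 1 ≤ t) (ω : Ω) :
    I.keyScore b n k t (queries b t) ω =
      3 / (8 * n) * (⌊b * t⌋₊ : ℝ) - I.keyCount b k t ω / 2 := by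
  classical
  rw [keyScore, ← sum_Icc_one_eq ht, ← sum_queries hb, keyCount]
  simp only [Finset.sum_sub_distrib, Finset.sum_const, Finset.card_range, nsmul_eq_mul,
    Nat.cast_sum, Finset.mul_sum, Finset.sum_div, Set.indicator_apply]
  congr 1
  · exact Finset.sum_congr rfl fun _ _ => mul_comm _ _
  · refine Finset.sum_congr rfl fun _ _ => Finset.sum_congr rfl fun _ _ => ?_
    split_ifs <;> norm_num

theorem measurable_keyScore {d : ℕ} [Fintype A] [Fintype K] [MeasurableSpace A] [MeasurableSpace K]
    [DiscreteMeasurableSpace K] (P : Problem d A K) (b : ℝ) (n : ℕ) (k : K) (t i : ℕ) :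
    Measurable[I.history P b t i] (I.keyScore b n k t i) := by
  have hf : Measurable fun a : K =>
      (3 / (8 * n) - ({k} : Set K).indicator (fun _ => (1 / 2 : ℝ)) a : ℝ) := Measurable.of_discrete
  refine (Finset.measurable_fun_sum _ fun τ hτ => Finset.measurable_fun_sum _ fun j hj => ?_).add
    (Finset.measurable_fun_sum _ fun j hj => ?_)
  · rw [Finset.mem_Ico] at hτ
    exact hf.comp (I.measurable_key_history P b hτ.1 hτ.2 (Finset.mem_range.mp hj))
  · exact hf.comp (I.measurable_key_history_self P b (Finset.mem_range.mp hj))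

end Interaction

/-- As e^(-1/2) ≤ 5/8, averaging e^(-1/2) and 1 with weights 1/n and 1 - 1/n gives at most 1 -
3/(8n) ≤ e^(-3/(8n)). This is the origin of the drift 3/(8n). -/
theorem exp_mul_one_sub_le_one {n : ℝ} (hn : 1 ≤ n) :
    Real.exp (3 / (8 * n) - 1 / 2) * (1 / n) + Real.exp (3 / (8 * n)) * (1 - 1 / n) ≤ 1 := by
  have h1 : Real.exp (-(1 / 2)) ≤ 5 / 8 := by
    rw [Real.exp_neg]
    have := Real.quadratic_le_exp_of_nonneg (show (0 : ℝ) ≤ 1 / 2 by norm_num)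
    exact (inv_le_comm₀ (Real.exp_pos _) (by norm_num)).mpr (by norm_num at this ⊢; linarith)
  have h2 : Real.exp (3 / (8 * n)) * (1 - 3 / (8 * n)) ≤ 1 := by
    have := Real.add_one_le_exp (-(3 / (8 * n)))
    calc _ ≤ Real.exp (3 / (8 * n)) * Real.exp (-(3 / (8 * n))) := by gcongr; linarith
      _ = 1 := by rw [← Real.exp_add]; simp
  refine le_trans ?_ h2
  rw [sub_eq_add_neg, Real.exp_add, mul_assoc, ← mul_add]
  gcongr
  calc _ ≤ 5 / 8 * (1 / n) + (1 - 1 / n) := by gcongr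
    _ = _ := by field_simp; ring

namespace IsConLinUCBBS

open scoped ENNReal

variable {d : ℕ} {Ω A K : Type*} [Fintype A] [Fintype K] [MeasurableSpace A]
  [DiscreteMeasurableSpace A] [MeasurableSpace K] [DiscreteMeasurableSpace K]
  {mΩ : MeasurableSpace Ω} {μ : Measure Ω} {P : Problem d A K} {B : Finset K} {b β δ : ℝ} {T : ℕ}
  {I : Interaction Ω A K}

omit [DiscreteMeasurableSpace A] in
theorem measure_key_eq (hI : IsConLinUCBBS μ P B b β δ T I) {k : K} (hk : k ∈ B) {t i : ℕ}
    (ht : t ∈ Finset.Icc 1 T) (hi : i < queries b t) :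
    μ (I.key t i ⁻¹' {k}) = ENNReal.ofReal (1 / B.card) := by
  classical
  have hcard : (0 : ℝ) < B.card := by exact_mod_cast Finset.card_pos.mpr ⟨k, hk⟩
  rw [← Measure.map_apply (hI.measurable_key t i) (measurableSet_singleton k),
    (hI.key_law t ht i hi).map_eq]
  have h := uniformOn_apply_finset (s := B) (t := {k})
  rw [Finset.coe_singleton, Finset.inter_singleton_of_mem hk] at h
  rw [h, ENNReal.ofReal_div_of_pos hcard]
  simp

omit [DiscreteMeasurableSpace A] in
theorem lintegral_exp_key_le [IsProbabilityMeasure μ] (hI : IsConLinUCBBS μ P B b β δ T I) {k : K}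
    (hk : k ∈ B) {t i : ℕ} (ht : t ∈ Finset.Icc 1 T) (hi : i < queries b t) :
    ∫⁻ ω, ENNReal.ofReal (Real.exp (3 / (8 * B.card) -
      ({k} : Set K).indicator (fun _ => (1 / 2 : ℝ)) (I.key t i ω))) ∂μ ≤ 1 := by
  have hcard : (1 : ℝ) ≤ B.card := by exact_mod_cast Finset.card_pos.mpr ⟨k, hk⟩
  have hm : MeasurableSet (I.key t i ⁻¹' {k}) :=
    hI.measurable_key t i (measurableSet_singleton k)
  have hp := hI.measure_key_eq hk ht hi
  have hpc : μ (I.key t i ⁻¹' {k})ᶜ = ENNReal.ofReal (1 - 1 / B.card) := by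
    rw [prob_compl_eq_one_sub hm, hp, ENNReal.ofReal_sub _ (by positivity), ENNReal.ofReal_one]
  rw [← lintegral_add_compl _ hm,
    setLIntegral_congr_fun (g := fun _ => ENNReal.ofReal (Real.exp (3 / (8 * B.card) - 1 / 2))) hm
      (fun ω hω => by
        have hω : I.key t i ω = k := hω
        simp [hω]),
    setLIntegral_congr_fun (g := fun _ => ENNReal.ofReal (Real.exp (3 / (8 * B.card)))) hm.compl
      (fun ω hω => by
        have hω : I.key t i ω ≠ k := hω
        simp [hω]),
    setLIntegral_const, setLIntegral_const, hp, hpc, ← ENNReal.ofReal_mul (Real.exp_pos _).le,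
    ← ENNReal.ofReal_mul (Real.exp_pos _).le, ← ENNReal.ofReal_add (by positivity)]
  · exact ENNReal.ofReal_le_one.mpr (exp_mul_one_sub_le_one hcard)
  · refine mul_nonneg (Real.exp_pos _).le (sub_nonneg.mpr ?_)
    rw [div_le_one (by linarith)]
    exact hcard

/-- Each new key-term is independent of the history, so the increment factors out with mean at most
1, and pulls leave the score unchanged. -/
theorem measure_exists_keyScore_le [IsProbabilityMeasure μ] (hI : IsConLinUCBBS μ P B b β δ T I)
    {k : K} (hk : k ∈ B) {ε : ℝ} (hε : 0 < ε) :
    μ {ω | ∃ t ∈ Finset.Icc 1 T, Real.log (1 / ε) ≤ I.keyScore b B.card k t (queries b t) ω} ≤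
      ENNReal.ofReal ε := by
  have h := hI.measure_exists_le_mul_le
    (Y := fun t i ω => ENNReal.ofReal (Real.exp (I.keyScore b B.card k t i ω)))
    (fun t i _ => ENNReal.measurable_ofReal.comp
      (Real.measurable_exp.comp (I.measurable_keyScore P b B.card k t i)))
    (fun t ht i hi E hE => by
      have hm := hI.history_le t i
      simp only [I.keyScore_succ_right, Real.exp_add, ENNReal.ofReal_mul (Real.exp_pos _).le]
      set f : Ω → ℝ≥0∞ := fun ω => ENNReal.ofReal (Real.exp (I.keyScore b B.card k t i ω))
      set g : Ω → ℝ≥0∞ := fun ω => ENNReal.ofReal (Real.exp (3 / (8 * B.card) -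
        ({k} : Set K).indicator (fun _ => (1 / 2 : ℝ)) (I.key t i ω)))
      have hf : Measurable[I.history P b t i] f := ENNReal.measurable_ofReal.comp
        (Real.measurable_exp.comp (I.measurable_keyScore P b B.card k t i))
      have hg : Measurable[MeasurableSpace.comap (I.key t i) inferInstance] g :=
        (Measurable.of_discrete (f := fun a : K => ENNReal.ofReal (Real.exp (3 / (8 * B.card) -
          ({k} : Set K).indicator (fun _ => (1 / 2 : ℝ)) a)))).comp (comap_measurable _)
      have hprod := lintegral_mul_eq_lintegral_mul_lintegral_of_independent_measurableSpace hm
        (hI.measurable_key t i).comap_le (hI.key_indep t ht i hi).symm (hf.indicator hE) hg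
      calc ∫⁻ ω in E, f ω * g ω ∂μ = ∫⁻ ω, E.indicator f ω * g ω ∂μ := by
            rw [← lintegral_indicator (hm _ hE)]
            refine lintegral_congr fun ω => ?_
            by_cases hω : ω ∈ E <;> simp [hω]
        _ = (∫⁻ ω, E.indicator f ω ∂μ) * ∫⁻ ω, g ω ∂μ := hprod
        _ ≤ (∫⁻ ω, E.indicator f ω ∂μ) * 1 := by
            gcongr
            exact hI.lintegral_exp_key_le hk ht hi
        _ = ∫⁻ ω in E, f ω ∂μ := by rw [mul_one, lintegral_indicator (hm _ hE)])
    (fun t ht E hE => by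
      simp only [I.keyScore_succ_left b B.card k (Finset.mem_Icc.mp ht).1]
      exact le_rfl)
    (ENNReal.ofReal (1 / ε))
  have hset : {ω | ∃ t ∈ Finset.Icc 1 T,
      Real.log (1 / ε) ≤ I.keyScore b B.card k t (queries b t) ω} =
      {ω | ∃ t ∈ Finset.Icc 1 T, ENNReal.ofReal (1 / ε) ≤
        ENNReal.ofReal (Real.exp (I.keyScore b B.card k t (queries b t) ω))} := by
    ext ω
    refine exists_congr fun t => and_congr_right fun _ => ?_
    rw [ENNReal.ofReal_le_ofReal_iff (Real.exp_pos _).le, Real.log_le_iff_le_exp (by positivity)]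
  have h0 : ∀ ω, I.keyScore b B.card k 1 0 ω = 0 := fun ω => by simp [Interaction.keyScore]
  rw [hset]
  simp only [h0, Real.exp_zero, ENNReal.ofReal_one, lintegral_one, measure_univ] at h
  rw [mul_comm] at h
  refine (ENNReal.le_div_iff_mul_le (Or.inl (by simpa using hε)) (Or.inl (by simp))).mpr h
    |>.trans_eq ?_
  rw [← ENNReal.ofReal_one, ← ENNReal.ofReal_div_of_pos (by positivity)]
  simp

/-- With high probability every key-term of `B` is asked at least its share, up to a logarithmic
deficit, simultaneously in all rounds. -/
theorem measure_exists_keyCount_le [IsProbabilityMeasure μ] (hI : IsConLinUCBBS μ P B b β δ T I)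
    (hb : 0 ≤ b) (hB : B.Nonempty) {ε : ℝ} (hε : 0 < ε) :
    μ {ω | ∃ k ∈ B, ∃ t ∈ Finset.Icc 1 T, I.keyCount b k t ω ≤
      3 / (4 * B.card) * (⌊b * t⌋₊ : ℝ) - 2 * Real.log (B.card / ε)} ≤ ENNReal.ofReal ε := by
  have hcard : (0 : ℝ) < B.card := by exact_mod_cast hB.card_pos
  -- Union bound with ε/|B| per key-term; the score carries half the count, which doubles the
  -- logarithm.
  calc _ ≤ μ (⋃ k ∈ B, {ω | ∃ t ∈ Finset.Icc 1 T,
        Real.log (1 / (ε / B.card)) ≤ I.keyScore b B.card k t (queries b t) ω}) := by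
        refine measure_mono ?_
        rintro ω ⟨k, hk, t, ht, h⟩
        refine Set.mem_biUnion hk ⟨t, ht, ?_⟩
        rw [I.keyScore_queries hb _ _ (Finset.mem_Icc.mp ht).1, one_div_div]
        have : (3 / (4 * B.card) : ℝ) = 2 * (3 / (8 * B.card)) := by field_simp; norm_num
        rw [this] at h
        linarith
    _ ≤ ∑ k ∈ B, μ {ω | ∃ t ∈ Finset.Icc 1 T,
        Real.log (1 / (ε / B.card)) ≤ I.keyScore b B.card k t (queries b t) ω} :=
        measure_biUnion_finset_le _ _
    _ ≤ ∑ k ∈ B, ENNReal.ofReal (ε / B.card) :=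
        Finset.sum_le_sum fun k hk => hI.measure_exists_keyScore_le hk (by positivity)
    _ = ENNReal.ofReal ε := by
        rw [Finset.sum_const, nsmul_eq_mul, ← ENNReal.ofReal_natCast,
          ← ENNReal.ofReal_mul hcard.le, mul_div_cancel₀ _ hcard.ne']

end IsConLinUCBBS

/-! ### Summing the regret over the rounds. -/

theorem alpha_mono {d : ℕ} {b β : ℝ} (hb : 0 ≤ b) (hβ : 0 < β) (ε : ℝ) :
    Monotone (alpha d b β ε) := by
  intro s t hst
  have hst' : (s : ℝ) ≤ t := by exact_mod_cast hst
  unfold alpha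
  gcongr

theorem alpha_nonneg (d : ℕ) (b β ε : ℝ) (t : ℕ) : 0 ≤ alpha d b β ε t :=
  add_nonneg (Real.sqrt_nonneg _) (Real.sqrt_nonneg _)

theorem sum_inv_sqrt_le (T : ℕ) : ∑ t ∈ Finset.Icc 1 T, (√(t : ℝ))⁻¹ ≤ 2 * √(T : ℝ) := by
  induction T with
  | zero => simp
  | succ T ih =>
    rw [Finset.sum_Icc_succ_top (by omega)]
    have h1 : 0 < √((T + 1 : ℕ) : ℝ) := Real.sqrt_pos.mpr (by positivity)
    have h2 := Real.sq_sqrt (show (0 : ℝ) ≤ ((T + 1 : ℕ) : ℝ) by positivity)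
    have h3 := Real.sq_sqrt (show (0 : ℝ) ≤ (T : ℝ) by positivity)
    -- With a = √(T+1) and c = √T, a² - c² = 1 turns this into (a - c)² ≥ 0.
    have h4 : (√((T + 1 : ℕ) : ℝ))⁻¹ ≤ 2 * √((T + 1 : ℕ) : ℝ) - 2 * √(T : ℝ) := by
      rw [inv_le_iff_one_le_mul₀ h1]
      push_cast at h2 ⊢
      nlinarith [sq_nonneg (√((T : ℝ) + 1) - √(T : ℝ))]
    linarith

theorem sum_ite_lt_le {x : ℝ} (hx : 0 ≤ x) (T : ℕ) :
    ∑ t ∈ Finset.Icc 1 T, (if (t : ℝ) < x then (2 : ℝ) else 0) ≤ 2 * x := by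
  rw [← Finset.sum_filter, Finset.sum_const, nsmul_eq_mul, mul_comm]
  have hsub : (Finset.Icc 1 T).filter (fun t : ℕ => (t : ℝ) < x) ⊆ Finset.Icc 1 ⌊x⌋₊ := by
    intro t ht
    rw [Finset.mem_filter, Finset.mem_Icc] at ht
    exact Finset.mem_Icc.mpr ⟨ht.1.1, Nat.le_floor ht.2.le⟩
  have hcard := Finset.card_le_card hsub
  rw [Nat.card_Icc, Nat.add_sub_cancel] at hcard
  have : (((Finset.Icc 1 T).filter (fun t : ℕ => (t : ℝ) < x)).card : ℝ) ≤ x :=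
    (Nat.cast_le.mpr hcard).trans (Nat.floor_le hx)
  linarith

/-- Here d/ε ≥ 8. The value 3/2 makes 2 d log(d/ε) ≥ 3, enough to absorb the rounding loss of ⌊bt⌋.
-/
theorem log_div_ge {d : ℕ} (hd : d ≠ 0) {ε : ℝ} (hε : 0 < ε) (hε1 : ε ≤ 1 / 8) :
    3 / 2 ≤ Real.log (d / ε) := by
  have h1 : (1 : ℝ) ≤ d := by exact_mod_cast Nat.one_le_iff_ne_zero.mpr hd
  have h2 : (2 : ℝ) ^ 3 ≤ d / ε := by
    rw [le_div_iff₀ hε]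
    linarith
  have h3 := Real.log_le_log (by norm_num) h2
  rw [Real.log_pow] at h3
  have := Real.log_two_gt_d9
  push_cast at h3
  linarith

namespace Interaction

variable {d : ℕ} {Ω A K : Type*} [Fintype A] [Fintype K]
  (I : Interaction Ω A K) (P : Problem d A K) {b β : ℝ}

theorem matNorm_inv_gram_le [NeZero d] {B : Finset K} (hB : P.IsBarycentricSpanner B) (hb : 0 < b)
    (hβ : 0 < β) {ε : ℝ} (hε : 0 < ε) (hε1 : ε ≤ 1 / 8) {t : ℕ} (ht : 1 ≤ t)
    (htb : 10 * d * Real.log (d / ε) / b ≤ t) {ω : Ω}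
    (hkeys : ∀ k ∈ B, 3 / (4 * B.card) * (⌊b * t⌋₊ : ℝ) - 2 * Real.log (B.card / ε) <
      I.keyCount b k t ω) (a : A) :
    matNorm (I.gram P b β t ω)⁻¹ (P.x a) ≤ √(2 / (b * P.lambdaB B)) * (√(t : ℝ))⁻¹ := by
  have hd : (1 : ℝ) ≤ d := by exact_mod_cast Nat.one_le_iff_ne_zero.mpr (NeZero.ne d)
  have ht' : (1 : ℝ) ≤ t := by exact_mod_cast ht
  have hl := P.lambdaB_pos hB
  have hL := log_div_ge (NeZero.ne d) hε hε1
  -- Of the share 3/4 a quarter is given up to the deficit: bt ≥ 3 + 8 d log(d/ε) is needed, and 10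
  -- d log(d/ε) is at least that.
  have hcount : ∀ k ∈ B, b * t / (2 * d) ≤ I.keyCount b k t ω := fun k hk => by
    refine le_trans ?_ (hkeys k hk).le
    rw [hB.1]
    have hfl : b * t - 1 ≤ (⌊b * t⌋₊ : ℝ) := (Nat.sub_one_lt_floor _).le
    rw [div_le_iff₀ hb] at htb
    have h1 : 3 / (4 * (d : ℝ)) * (b * t - 1) ≤ 3 / (4 * d) * (⌊b * t⌋₊ : ℝ) := by gcongr
    refine le_trans ?_ (sub_le_sub_right h1 _)
    have h2 : 3 / (4 * (d : ℝ)) * (b * t - 1) - 2 * Real.log (d / ε) - b * t / (2 * d) =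
        (b * t - (3 + 8 * d * Real.log (d / ε))) / (4 * d) := by
      field_simp
      ring
    have h3 : 0 ≤ (b * t - (3 + 8 * d * Real.log (d / ε))) / (4 * d) := by
      refine div_nonneg ?_ (by positivity)
      nlinarith
    linarith
  -- Equal counts bt/(2d) turn the sum over B into bt/2 times the second-moment form, bounded below
  -- by λ_B.
  have hquad : ∀ v, b * t * P.lambdaB B / 2 * (v ⬝ᵥ v) ≤ v ⬝ᵥ I.gram P b β t ω *ᵥ v := fun v => by
    refine le_trans ?_ (I.sum_keyCount_le_dotProduct_gram_mulVec P hβ.le B t ω v)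
    have h1 := P.lambdaB_mul_le B v
    rw [hB.1] at h1
    calc b * t * P.lambdaB B / 2 * (v ⬝ᵥ v) = b * t / 2 * (P.lambdaB B * (v ⬝ᵥ v)) := by ring
      _ ≤ b * t / 2 * ((d : ℝ)⁻¹ * ∑ k ∈ B, (P.xt k ⬝ᵥ v) ^ 2) := by gcongr
      _ = ∑ k ∈ B, b * t / (2 * d) * (P.xt k ⬝ᵥ v) ^ 2 := by
        rw [← Finset.mul_sum]
        field_simp
      _ ≤ _ := Finset.sum_le_sum fun k hk => by gcongr; exact hcount k hk
  refine (matNorm_inv_le (I.gram_posDef P hβ t ω) (by positivity) hquad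
    (P.dotProduct_x_self a).le).trans_eq ?_
  rw [← Real.sqrt_inv, ← Real.sqrt_mul (by positivity)]
  congr 1
  field_simp

theorem regret_le [NeZero d] {B : Finset K} (hB : P.IsBarycentricSpanner B) (hb : 0 < b)
    (hβ : 0 < β) {ε : ℝ} (hε : 0 < ε) (hε1 : ε ≤ 1 / 8) {T : ℕ} {ω : Ω}
    (hkeys : ∀ k ∈ B, ∀ t ∈ Finset.Icc 1 T,
      3 / (4 * B.card) * (⌊b * t⌋₊ : ℝ) - 2 * Real.log (B.card / ε) < I.keyCount b k t ω)
    (hconf : ∀ t ∈ Finset.Icc 1 T, mixture (I.gram P b β t ω) (I.noiseAt P b t (queries b t) ω) <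
      ENNReal.ofReal (1 / ε * (√(β ^ d))⁻¹))
    (hmem : ∀ t ∈ Finset.Icc 1 T, I.arm t ω ∈ I.avail t ω)
    (hmax : ∀ t ∈ Finset.Icc 1 T,
      ∀ a ∈ I.avail t ω, I.index P b β ε t ω a ≤ I.index P b β ε t ω (I.arm t ω)) :
    I.regret P T ω ≤ 4 * √(2 / (b * P.lambdaB B)) * √T * alpha d b β ε T +
      20 * d * Real.log (d / ε) / b := by
  have hL := log_div_ge (NeZero.ne d) hε hε1
  set x := 10 * d * Real.log (d / ε) / b with hx
  have hx0 : 0 ≤ x := by positivity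
  have hα := alpha_nonneg d b β ε T
  -- Before time x the key-term counts guarantee nothing, and the trivial bound 2 is used.
  have hround : ∀ t ∈ Finset.Icc 1 T, I.roundRegret P t ω ≤
      2 * alpha d b β ε T * √(2 / (b * P.lambdaB B)) * (√(t : ℝ))⁻¹ +
        if (t : ℝ) < x then 2 else 0 := fun t ht => by
    obtain ⟨ht1, htT⟩ := Finset.mem_Icc.mp ht
    split_ifs with htx
    · have := I.roundRegret_le_two P t ω
      have : 0 ≤ 2 * alpha d b β ε T * √(2 / (b * P.lambdaB B)) * (√(t : ℝ))⁻¹ := by positivity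
      linarith
    · rw [add_zero, mul_assoc]
      refine (I.roundRegret_le P (fun a => I.abs_dotProduct_estimate_sub_le P hb.le hβ hε ht1
        (hconf t ht) (P.x a)) (hmem t ht) (hmax t ht)).trans ?_
      have h1 := I.matNorm_inv_gram_le P hB hb hβ hε hε1 ht1 (not_lt.mp htx)
        (fun k hk => hkeys k hk t ht) (I.arm t ω)
      have h2 := alpha_mono (d := d) hb.le hβ ε htT
      have h3 := alpha_nonneg d b β ε t
      have h4 : 0 ≤ matNorm (I.gram P b β t ω)⁻¹ (P.x (I.arm t ω)) := Real.sqrt_nonneg _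
      gcongr
  calc I.regret P T ω = ∑ t ∈ Finset.Icc 1 T, I.roundRegret P t ω := rfl
    _ ≤ _ := Finset.sum_le_sum hround
    _ = 2 * alpha d b β ε T * √(2 / (b * P.lambdaB B)) * ∑ t ∈ Finset.Icc 1 T, (√(t : ℝ))⁻¹ +
        ∑ t ∈ Finset.Icc 1 T, (if (t : ℝ) < x then (2 : ℝ) else 0) := by
      rw [Finset.sum_add_distrib, Finset.mul_sum]
    _ ≤ 2 * alpha d b β ε T * √(2 / (b * P.lambdaB B)) * (2 * √(T : ℝ)) + 2 * x := by
      gcongr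
      · exact sum_inv_sqrt_le T
      · exact sum_ite_lt_le hx0 T
    _ = _ := by rw [hx]; ring

end Interaction

/-- Subadditivity alone suffices, so the event need not be measurable. -/
theorem one_sub_le_measureReal {Ω : Type*} [MeasurableSpace Ω] {μ : Measure Ω}
    [IsProbabilityMeasure μ] {s : Set Ω} {δ : ℝ} (hδ : 0 ≤ δ) (h : μ sᶜ ≤ ENNReal.ofReal δ) :
    1 - δ ≤ μ.real s := by
  have h1 : μ.real sᶜ ≤ δ := ENNReal.toReal_le_of_le_ofReal hδ h
  have h2 := measureReal_union_le (μ := μ) s sᶜ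
  rw [Set.union_compl_self, probReal_univ] at h2
  linarith

namespace IsConLinUCBBS

variable {d : ℕ} {Ω A K : Type*} [Fintype A] [Fintype K] [MeasurableSpace A]
  [DiscreteMeasurableSpace A] [MeasurableSpace K] [DiscreteMeasurableSpace K]
  {mΩ : MeasurableSpace Ω} {μ : Measure Ω} {P : Problem d A K} {B : Finset K} {b β ε : ℝ} {T : ℕ}
  {I : Interaction Ω A K}

/-- The regret bound in terms of the dimension, with confidence level `ε` for each of the two
failure events. -/
theorem one_sub_le_measureReal_regret_le [NeZero d] [IsProbabilityMeasure μ]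
    (hI : IsConLinUCBBS μ P B b β ε T I) (hB : P.IsBarycentricSpanner B) (hb : 0 < b) (hβ : 0 < β)
    (hε : 0 < ε) (hε1 : ε ≤ 1 / 8) :
    1 - 2 * ε ≤ μ.real {ω | I.regret P T ω ≤
      4 * √(2 / (b * P.lambdaB B)) * √T * alpha d b β ε T +
        20 * d * Real.log (d / ε) / b} := by
  have hne : B.Nonempty := Finset.card_pos.mp (by rw [hB.1]; exact Nat.pos_of_ne_zero (NeZero.ne d))
  have hmem : ∀ᵐ ω ∂μ, ∀ t ∈ Finset.Icc 1 T, I.arm t ω ∈ I.avail t ω :=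
    (Finset.eventually_all _).mpr hI.arm_mem
  have hmax : ∀ᵐ ω ∂μ, ∀ t ∈ Finset.Icc 1 T,
      ∀ a ∈ I.avail t ω, I.index P b β ε t ω a ≤ I.index P b β ε t ω (I.arm t ω) :=
    (Finset.eventually_all _).mpr hI.arm_max
  refine one_sub_le_measureReal (by positivity) ?_
  set bad₁ := {ω | ∃ t ∈ Finset.Icc 1 T, ENNReal.ofReal (1 / ε * (√(β ^ d))⁻¹) ≤
      mixture (I.gram P b β t ω) (I.noiseAt P b t (queries b t) ω)}
  set bad₂ := {ω | ∃ k ∈ B, ∃ t ∈ Finset.Icc 1 T, I.keyCount b k t ω ≤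
      3 / (4 * B.card) * (⌊b * t⌋₊ : ℝ) - 2 * Real.log (B.card / ε)}
  calc _ ≤ μ (bad₁ ∪ bad₂) := by
        refine measure_mono_ae ?_
        filter_upwards [hmem, hmax] with ω h1 h2 h3
        by_contra hgood
        refine h3 (I.regret_le P hB hb hβ hε hε1 (fun k hk t ht => ?_) (fun t ht => ?_) h1 h2)
        · exact not_le.mp fun hle => hgood (Or.inr ⟨k, hk, t, ht, hle⟩)
        · exact not_le.mp fun hle => hgood (Or.inl ⟨t, ht, hle⟩)
    _ ≤ μ bad₁ + μ bad₂ := measure_union_le _ _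
    _ ≤ ENNReal.ofReal ε + ENNReal.ofReal ε :=
        add_le_add (hI.measure_exists_mixture_le hβ hε) (hI.measure_exists_keyCount_le hb.le hne hε)
    _ = ENNReal.ofReal (2 * ε) := by rw [← ENNReal.ofReal_add hε.le hε.le, two_mul]

end IsConLinUCBBS

/-! ### Elementary estimates leading to the two stated forms of the bound. -/

theorem alpha_half (d : ℕ) (b β δ : ℝ) (T : ℕ) : alpha d b β (δ / 2) T =
    √(2 * Real.log (2 / δ) + d * Real.log (1 + (1 + b) * T / (β * d))) + √β := by
  rw [alpha, one_div_div]
  congr 6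
  ring

/-- From λ ≤ 1/d follow dλ² ≤ 1 and λ ≤ 1, which leaves ample room in both constants 256. -/
theorem dim_mul_log_le {d : ℕ} (hd : d ≠ 0) {b l δ : ℝ} (hb : 0 < b) (hδ : 0 < δ)
    (hδ1 : δ ≤ 1 / 4) (hl : 0 < l) (hld : l ≤ 1 / d) :
    20 * d * Real.log (d / (δ / 2)) / b ≤
      256 / (b * l ^ 2) * Real.log (256 * d / (l ^ 2 * δ)) + 1 := by
  have hd1 : (1 : ℝ) ≤ d := by exact_mod_cast Nat.one_le_iff_ne_zero.mpr hd
  have hL := log_div_ge hd (half_pos hδ) (by linarith)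
  rw [le_div_iff₀ (by positivity)] at hld
  have hl1 : l ≤ 1 := by nlinarith
  have h1 : d * l ^ 2 ≤ 1 := by nlinarith
  have h2 : Real.log (d / (δ / 2)) ≤ Real.log (256 * d / (l ^ 2 * δ)) := by
    refine Real.log_le_log (by positivity) ?_
    rw [div_le_div_iff₀ (by positivity) (by positivity)]
    have : l ^ 2 ≤ 1 := by nlinarith
    nlinarith [mul_pos (show (0 : ℝ) < d by linarith) hδ]
  have h3 : 20 * d / b ≤ 256 / (b * l ^ 2) := by
    rw [div_le_div_iff₀ hb (by positivity)]
    nlinarith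
  calc 20 * d * Real.log (d / (δ / 2)) / b = 20 * d / b * Real.log (d / (δ / 2)) := by ring
    _ ≤ 256 / (b * l ^ 2) * Real.log (256 * d / (l ^ 2 * δ)) := by gcongr
    _ ≤ _ := by linarith

/-- The constant of the bound `R(T) ≤ C d √(T log T)`. -/
noncomputable def regretConst (b β δ c : ℝ) : ℝ :=
  3 + 4 * √(2 / (b * c)) *
      (√(3 * Real.log (2 / δ) + 1 + 3 / 2 * Real.log (1 + 2 / β)) + √(3 / 2 * β)) +
    20 / b * (3 / 2 * Real.log (2 / δ) + 1)

theorem two_thirds_le_log {T : ℕ} (hT : 2 ≤ T) : 2 / 3 ≤ Real.log T := by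
  have h1 : Real.log 2 ≤ Real.log T := Real.log_le_log (by norm_num) (by exact_mod_cast hT)
  have := Real.log_two_gt_d9
  linarith

theorem two_mul_le_of_sqrt_le {d : ℝ} {T : ℕ} (hT : 2 ≤ T) (h : √T ≤ d) :
    2 * T ≤ 3 * d * √(T * Real.log T) := by
  have hl := two_thirds_le_log hT
  -- Because (2/3)² ≤ 2/3 ≤ log T.
  have h1 : 2 / 3 ≤ √(Real.log T) := Real.le_sqrt_of_sq_le (by nlinarith)
  have h0 := Real.sqrt_nonneg (T : ℝ)
  have hd0 : 0 ≤ d := h0.trans h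
  rw [Real.sqrt_mul (by positivity)]
  calc 2 * (T : ℝ) = 3 * √T * (√T * (2 / 3)) := by
        nlinarith [Real.mul_self_sqrt (show (0 : ℝ) ≤ T by positivity)]
    _ ≤ 3 * d * (√T * √(Real.log T)) := by gcongr

theorem alpha_half_le {d : ℕ} (hd : d ≠ 0) {b β δ : ℝ} (hb : 0 < b) (hb1 : b < 1) (hβ : 0 < β)
    (hδ : 0 < δ) (hδ1 : δ ≤ 1 / 4) {T : ℕ} (hT : 2 ≤ T) :
    alpha d b β (δ / 2) T ≤ √d * √(Real.log T) *
      (√(3 * Real.log (2 / δ) + 1 + 3 / 2 * Real.log (1 + 2 / β)) + √(3 / 2 * β)) := by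
  have hd1 : (1 : ℝ) ≤ d := by exact_mod_cast Nat.one_le_iff_ne_zero.mpr hd
  have hT1 : (2 : ℝ) ≤ T := by exact_mod_cast hT
  have hl := two_thirds_le_log hT
  have hD : 0 ≤ Real.log (2 / δ) := Real.log_nonneg (by rw [le_div_iff₀ hδ]; linarith)
  have hE : 0 ≤ Real.log (1 + 2 / β) := Real.log_nonneg (by
    have : 0 < 2 / β := by positivity
    linarith)
  -- Terms free of T are multiplied by this to extract the factor d log T; it produces the factors
  -- 3/2 inside `regretConst`.
  have hdl : 1 ≤ 3 / 2 * (d * Real.log T) := by nlinarith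
  have hlog : Real.log (1 + (1 + b) * T / (β * d)) ≤ Real.log T + Real.log (1 + 2 / β) := by
    rw [← Real.log_mul (by positivity) (by positivity)]
    refine Real.log_le_log (by positivity) ?_
    have h1 : (1 + b) * T / (β * d) ≤ 2 * T / (β * 1) := by gcongr; linarith
    calc _ ≤ T + 2 * T / (β * 1) := by linarith
      _ = _ := by field_simp
  rw [alpha_half, mul_add, ← Real.sqrt_mul (by positivity), ← Real.sqrt_mul (by positivity),
    ← Real.sqrt_mul (by positivity)]
  gcongr
  · have h1 : d * Real.log (1 + (1 + b) * T / (β * d)) ≤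
        d * (Real.log T + Real.log (1 + 2 / β)) := by gcongr
    nlinarith [mul_le_mul_of_nonneg_left hdl hD, mul_le_mul_of_nonneg_left hl
      (mul_nonneg (show (0 : ℝ) ≤ d by linarith) hE)]
  · nlinarith

theorem dim_mul_log_le_of_le {d : ℕ} (hd : d ≠ 0) {b δ : ℝ} (hb : 0 < b) (hδ : 0 < δ)
    (hδ1 : δ ≤ 1 / 4) {T : ℕ} (hT : 2 ≤ T) (hdT : (d : ℝ) ≤ T) :
    20 * d * Real.log (d / (δ / 2)) / b ≤
      20 / b * (3 / 2 * Real.log (2 / δ) + 1) * (d * √(T * Real.log T)) := by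
  have hd1 : (1 : ℝ) ≤ d := by exact_mod_cast Nat.one_le_iff_ne_zero.mpr hd
  have hT1 : (2 : ℝ) ≤ T := by exact_mod_cast hT
  have hl := two_thirds_le_log hT
  have hD : 0 ≤ Real.log (2 / δ) := Real.log_nonneg (by rw [le_div_iff₀ hδ]; linarith)
  have h1 : Real.log (d / (δ / 2)) ≤ (3 / 2 * Real.log (2 / δ) + 1) * Real.log T := by
    rw [show (d : ℝ) / (δ / 2) = d * (2 / δ) by field_simp,
      Real.log_mul (by positivity) (by positivity)]
    have := Real.log_le_log (by positivity) hdT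
    nlinarith
  have h2 : Real.log T ≤ √(T * Real.log T) := by
    refine Real.le_sqrt_of_sq_le ?_
    rw [sq]
    have := Real.log_le_self (show (0 : ℝ) ≤ T by positivity)
    gcongr
  calc 20 * d * Real.log (d / (δ / 2)) / b = 20 / b * d * Real.log (d / (δ / 2)) := by ring
    _ ≤ 20 / b * d * ((3 / 2 * Real.log (2 / δ) + 1) * √(T * Real.log T)) := by
      gcongr
      exact h1.trans (by gcongr)
    _ = _ := by ring

/-- A probability space has a point, hence there is an arm, and a unit vector excludes dimension
zero. -/
theorem Interaction.neZero_dim {d : ℕ} {Ω A K : Type*} [Fintype A] [Fintype K] [MeasurableSpace Ω]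
    (I : Interaction Ω A K) (P : Problem d A K) (μ : Measure Ω) [IsProbabilityMeasure μ] :
    NeZero d := by
  obtain ⟨ω⟩ := nonempty_of_isProbabilityMeasure μ
  have : Nonempty A := ⟨I.arm 0 ω⟩
  exact ⟨P.dim_ne_zero⟩

theorem regretConst_pos {b β δ c : ℝ} (hb : 0 < b) (hδ : 0 < δ) (hδ1 : δ ≤ 1 / 4) :
    0 < regretConst b β δ c := by
  have hD : 0 ≤ Real.log (2 / δ) := Real.log_nonneg (by rw [le_div_iff₀ hδ]; linarith)
  unfold regretConst
  positivity

/-- The three summands of `regretConst` pay for the regime √T ≤ d, the main term and the early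
rounds. In the main term λ ≥ c/d contributes one √d and `alpha` the other. -/
theorem le_regretConst_mul {d : ℕ} (hd : d ≠ 0) {b β δ c l : ℝ} (hb : 0 < b) (hb1 : b < 1)
    (hβ : 0 < β) (hδ : 0 < δ) (hδ1 : δ ≤ 1 / 4) (hc : 0 < c) (hl : c / d ≤ l) {T : ℕ} (hT : 2 ≤ T)
    {R : ℝ} (h2T : R ≤ 2 * T)
    (hR : R ≤ 4 * √(2 / (b * l)) * √T * alpha d b β (δ / 2) T +
      20 * d * Real.log (d / (δ / 2)) / b) :
    R ≤ regretConst b β δ c * d * √(T * Real.log T) := by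
  have hd1 : (1 : ℝ) ≤ d := by exact_mod_cast Nat.one_le_iff_ne_zero.mpr hd
  have hD : 0 ≤ Real.log (2 / δ) := Real.log_nonneg (by rw [le_div_iff₀ hδ]; linarith)
  set G := √(3 * Real.log (2 / δ) + 1 + 3 / 2 * Real.log (1 + 2 / β)) + √(3 / 2 * β) with hG
  have hsplit : regretConst b β δ c * d * √(T * Real.log T) = 3 * d * √(T * Real.log T) +
      4 * √(2 / (b * c)) * G * (d * √(T * Real.log T)) +
      20 / b * (3 / 2 * Real.log (2 / δ) + 1) * (d * √(T * Real.log T)) := by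
    rw [regretConst, ← hG]
    ring
  have hp1 : 0 ≤ 3 * d * √(T * Real.log T) := by positivity
  have hp2 : 0 ≤ 4 * √(2 / (b * c)) * G * (d * √(T * Real.log T)) := by positivity
  have hp3 : 0 ≤ 20 / b * (3 / 2 * Real.log (2 / δ) + 1) * (d * √(T * Real.log T)) := by
    positivity
  rw [hsplit]
  rcases le_total (√T) (d : ℝ) with hdT | hdT
  · have := two_mul_le_of_sqrt_le hT hdT
    linarith
  · have hT1 : (1 : ℝ) ≤ T := by exact_mod_cast (by omega : 1 ≤ T)
    have hdT' : (d : ℝ) ≤ T := hdT.trans (Real.sqrt_le_left (by linarith) |>.mpr (by nlinarith))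
    have h1 := dim_mul_log_le_of_le hd hb hδ hδ1 hT hdT'
    have h2 := alpha_half_le hd hb hb1 hβ hδ hδ1 hT
    have h3 : √(2 / (b * l)) ≤ √(2 / (b * c)) * √d := by
      rw [← Real.sqrt_mul (by positivity)]
      refine Real.sqrt_le_sqrt ?_
      calc 2 / (b * l) ≤ 2 / (b * (c / d)) := by gcongr
        _ = _ := by field_simp
    have h4 : 4 * √(2 / (b * l)) * √T * alpha d b β (δ / 2) T ≤
        4 * √(2 / (b * c)) * G * (d * √(T * Real.log T)) := by
      calc _ ≤ 4 * (√(2 / (b * c)) * √d) * √T * (√d * √(Real.log T) * G) := by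
            have := alpha_nonneg d b β (δ / 2) T
            gcongr
        _ = 4 * √(2 / (b * c)) * G * ((√d * √d) * (√T * √(Real.log T))) := by ring
        _ = _ := by
          rw [Real.mul_self_sqrt (by positivity), Real.sqrt_mul (by positivity)]
    linarith

end ConvBandit

theorem theorem1 (b β δ : ℝ) (hb : 0 < b) (hb1 : b < 1) (hβ : 0 < β) (hδ : 0 < δ)
    (hδ1 : δ ≤ 1 / 4) :
    (∀ (d T : ℕ) (A K Ω : Type*) [Fintype A] [Fintype K]
        [MeasurableSpace A] [DiscreteMeasurableSpace A]
        [MeasurableSpace K] [DiscreteMeasurableSpace K]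
        [MeasurableSpace Ω] (μ : Measure Ω) [IsProbabilityMeasure μ]
        (P : ConvBandit.Problem d A K) (B : Finset K) (I : ConvBandit.Interaction Ω A K),
        P.IsBarycentricSpanner B →
        ConvBandit.IsConLinUCBBS μ P B b β (δ / 2) T I →
        0 < P.lambdaB B ∧ P.lambdaB B ≤ 1 / d ∧
        1 - δ ≤ μ.real {ω | I.regret P T ω ≤
          4 * √(2 / (b * P.lambdaB B)) * √T *
              (√(2 * Real.log (2 / δ) + d * Real.log (1 + (1 + b) * T / (β * d))) + √β) +
            256 / (b * P.lambdaB B ^ 2) * Real.log (256 * d / (P.lambdaB B ^ 2 * δ)) + 1}) ∧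
    (∀ c : ℝ, 0 < c → ∃ C : ℝ, 0 < C ∧
      ∀ (d T : ℕ) (A K Ω : Type*) [Fintype A] [Fintype K]
        [MeasurableSpace A] [DiscreteMeasurableSpace A]
        [MeasurableSpace K] [DiscreteMeasurableSpace K]
        [MeasurableSpace Ω] (μ : Measure Ω) [IsProbabilityMeasure μ]
        (P : ConvBandit.Problem d A K) (B : Finset K) (I : ConvBandit.Interaction Ω A K),
        P.IsBarycentricSpanner B →
        ConvBandit.IsConLinUCBBS μ P B b β (δ / 2) T I →
        c / d ≤ P.lambdaB B → 2 ≤ T →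
        1 - δ ≤ μ.real {ω | I.regret P T ω ≤ C * d * √(T * Real.log T)}) := by
  -- The confidence δ is shared equally by the two failure events.
  have hε : 0 < δ / 2 := half_pos hδ
  have hε1 : δ / 2 ≤ 1 / 8 := by linarith
  have h2ε : 2 * (δ / 2) = δ := by ring
  refine ⟨?_, fun c hc => ⟨ConvBandit.regretConst b β δ c,
    ConvBandit.regretConst_pos hb hδ hδ1, ?_⟩⟩
  · intro d T A K Ω _ _ _ _ _ _ _ μ _ P B I hB hI
    have := I.neZero_dim P μ
    have hpos := P.lambdaB_pos hB
    have hle := P.lambdaB_le hB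
    refine ⟨hpos, hle, ?_⟩
    have h := hI.one_sub_le_measureReal_regret_le hB hb hβ hε hε1
    rw [h2ε] at h
    refine h.trans (measureReal_mono fun ω hω => ?_)
    have hlow := ConvBandit.dim_mul_log_le (NeZero.ne d) hb hδ hδ1 hpos hle
    rw [Set.mem_ofPred_eq, ConvBandit.alpha_half] at hω
    rw [Set.mem_ofPred_eq]
    linarith
  · intro d T A K Ω _ _ _ _ _ _ _ μ _ P B I hB hI hcd hT
    have := I.neZero_dim P μ
    have h := hI.one_sub_le_measureReal_regret_le hB hb hβ hε hε1
    rw [h2ε] at h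
    exact h.trans (measureReal_mono fun ω hω => ConvBandit.le_regretConst_mul (NeZero.ne d) hb hb1
      hβ hδ hδ1 hc hcd hT (I.regret_le_two_mul P T ω) hω)
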